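/- Let $N\ge 1$ and $d\ge 0$ be integers, and write $x=(x_1,\dots,x_N)\in\mathbb{R}^{Nd}$ with $x_i\in\mathbb{R}^d$, $\widehat{x}_i=(x_1,\dots,x_{i-1},x_{i+1},\dots,x_N)$. Here a probability density is an integrable function that is nonnegative a.e. and has integral $1$ with respect to Lebesgue measure, and $H^1$ is the usual Sobolev space of real functions $u\in L^2$ whose weak gradient belongs to $L^2$. Let $\gamma_A$ be a probability density on $\mathbb{R}^{Nd}$ whose one-body marginals all coincide with one function $\mu_A$ on $\mathbb{R}^d$, i.e. $\int_{\mathbb{R}^{(N-1)d}}\gamma_A(x)\,d\widehat{x}_i=\mu_A(x_i)$ for a.e. $x_i$ and all $i=1,\dots,N$. Suppose that $\gamma_A$ is strongly positive: there is a constant $\beta>0$ such that for every $i=1,\dots,N$ $$\gamma_A(x_1,\dots,x_N)\ \ge\ \beta\,\Bigl(\int\gamma_A\,d\widehat{x}_i\Bigr)(x_i)\;\Bigl(\int\gamma_A\,dx_i\Bigr)(\widehat{x}_i)\qquad\text{for a.e. }x\in\mathbb{R}^{Nd}.$$ Let $\mu_B$ be a probability density on $\mathbb{R}^d$. Put $f=\min\{\mu_A,\mu_B\}$,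 $f_A=(\mu_A-f)_+$, $f_B=(\mu_B-f)_+$, where $h_+=\max\{h,0\}$, $$\gamma_{B,A}(x,x')=f(x)\,\delta_x(x')+\frac{f_B(x)f_A(x')}{\int f_B}$$ (for each $x$ a measure in $x'$; the second term is $0$ if $\mu_A=\mu_B$ a.e.), and define the projected plan $$P\gamma_A(x_1,\dots,x_N)=\int_{\mathbb{R}^d}\!\cdots\!\int_{\mathbb{R}^d}\frac{\gamma_{B,A}(x_1,x_1')}{\mu_A(x_1')}\cdots\frac{\gamma_{B,A}(x_N,x_N')}{\mu_A(x_N')}\,\gamma_A(x_1',\dots,x_N')\,dx_1'\cdots dx_N',$$ where quotients with $\mu_A(x_i')=0$ are read as $0$. If $\sqrt{\gamma_A}\in H^1(\mathbb{R}^{Nd})$ and $\sqrt{\mu_B}\in H^1(\mathbb{R}^d)$, then $P\gamma_A$ is a probability density on $\mathbb{R}^{Nd}$ all of whose one-body marginals equal $\mu_B$ a.e., and $\sqrt{P\gamma_A}\in H^1(\mathbb{R}^{Nd})$. -/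

import Mathlib

open MeasureTheory
open scoped ContDiff

noncomputable section

namespace SobPres

/-- The one-particle space `ℝ^d`. -/
abbrev Pt (d : ℕ) : Type := EuclideanSpace ℝ (Fin d)

/-- The configuration space `ℝ^{Nd}`, whose points are `x = (x_1, …, x_N)` with `x_i ∈ ℝ^d`;
its `volume` is the `Nd`-dimensional Lebesgue measure. -/
abbrev Conf (N d : ℕ) : Type := Fin N → Pt d

/-- `ρ` is a probability density with respect to Lebesgue measure. -/
structure IsProbDensity {X : Type*} [MeasureSpace X] (ρ : X → ℝ) : Prop where
  integrable : Integrable ρ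
  nonneg : ∀ᵐ x, 0 ≤ ρ x
  integral_eq_one : ∫ x, ρ x = 1

/-- `g` is the weak (distributional) derivative of `u` in the direction `v`. -/
def IsWeakDeriv {X : Type*} [NormedAddCommGroup X] [NormedSpace ℝ X] [MeasureSpace X]
    (u : X → ℝ) (v : X) (g : X → ℝ) : Prop :=
  ∀ φ : X → ℝ, ContDiff ℝ ∞ φ → HasCompactSupport φ →
    ∫ x, u x * fderiv ℝ φ x v = -∫ x, g x * φ x

/-- `u ∈ H¹`: `u ∈ L²`, and in every direction `u` has a weak derivative belonging to `L²`.
(Weak differentiability does not depend on the choice of the norm on `X`.) -/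
def MemH1 {X : Type*} [NormedAddCommGroup X] [NormedSpace ℝ X] [MeasureSpace X]
    (u : X → ℝ) : Prop :=
  MemLp u 2 ∧ ∀ v : X, ∃ g : X → ℝ, MemLp g 2 ∧ IsWeakDeriv u v g

/-- The `i`-th one-body marginal `x_i ↦ ∫ γ(x_1, …, x_N) dx̂_i`, the integral being over all
coordinates other than `x_i`. Here `N = n + 1`. -/
def oneMarginal {n d : ℕ} (γ : Conf (n + 1) d → ℝ) (i : Fin (n + 1)) (t : Pt d) : ℝ :=
  ∫ y : Conf n d, γ (i.insertNth t y)

/-- The complementary `(N-1)`-body marginal `x̂_i ↦ ∫ γ(x_1, …, x_N) dx_i`. -/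
def restMarginal {n d : ℕ} (γ : Conf (n + 1) d → ℝ) (i : Fin (n + 1)) (y : Conf n d) : ℝ :=
  ∫ t : Pt d, γ (i.insertNth t y)

/-- Strong positivity: for one constant `β > 0` and every `i`,
`γ(x) ≥ β (∫ γ dx̂_i)(x_i) (∫ γ dx_i)(x̂_i)` for almost every `x`. -/
def StronglyPositive {n d : ℕ} (γ : Conf (n + 1) d → ℝ) : Prop :=
  ∃ β : ℝ, 0 < β ∧ ∀ i : Fin (n + 1), ∀ᵐ x : Conf (n + 1) d,
    β * oneMarginal γ i (x i) * restMarginal γ i (i.removeNth x) ≤ γ x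

/-- `f = min{μ_A, μ_B}`. -/
def common {d : ℕ} (μA μB : Pt d → ℝ) (x : Pt d) : ℝ := min (μA x) (μB x)

/-- `(μ - f)_+` with `f = min{μ, ν}`. Thus `f_A = excess μA μB` and `f_B = excess μB μA`. -/
def excess {d : ℕ} (μ ν : Pt d → ℝ) (x : Pt d) : ℝ := max (μ x - common μ ν x) 0

/-- The transport plan `γ_{B,A}(x, x') = f(x) δ_x(x') + f_B(x) f_A(x') / ∫ f_B`, for fixed `x` as
a measure in `x'`. If `μA = μB` then `f_B = 0`, and the second term is zero. -/
def planBA {d : ℕ} (μA μB : Pt d → ℝ) (x : Pt d) : Measure (Pt d) :=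
  ENNReal.ofReal (common μA μB x) • Measure.dirac x +
    ENNReal.ofReal (excess μB μA x / ∫ z, excess μB μA z) •
      volume.withDensity (fun x' => ENNReal.ofReal (excess μA μB x'))

/-- The projected plan
`Pγ_A(x) = ∫ ⋯ ∫ ∏_i (γ_{B,A}(x_i, x_i') / μ_A(x_i')) γ_A(x') dx_1' ⋯ dx_N'`,
that is, the integral of `γ_A(x') / ∏_i μ_A(x_i')` against the product of the measures
`γ_{B,A}(x_i, dx_i')`. -/
def proj {N d : ℕ} (μA μB : Pt d → ℝ) (γA : Conf N d → ℝ) (x : Conf N d) : ℝ :=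
  ∫ x' : Conf N d, (∏ i, (μA (x' i))⁻¹) * γA x' ∂(Measure.pi fun i => planBA μA μB (x i))

end SobPres

end

/-! Given `u ∈ L²`, membership in H¹ is equivalent to `‖u(· + s v) - u‖₂ ≤ C |s|` for every
direction `v`, and directions moving a single particle suffice. This replaces weak derivatives of
square roots by estimates of finite increments.

Write `μ`, `ν` for `μ_A`, `μ_B` and `f` for their minimum. Fix a particle `i`, with position `t`,
and let `y` be the others. Projecting all coordinates but the `i`-th gives `G(t, y)` (`projRest`),
with mass `R(y) = ∫ G dt`. Projecting the last coordinate yields `Pγ = (f/μ)(t) G(t, y) + f_B(t)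
h(y)`, where `h ≤ K R` and `K = 1/∫ f_B` (`ae_proj_insertNth_eq`). Averaging over the plan does not
increase L² increments of square roots (`lintegral_sqrt_projRest_sub_le`), so those of `√G`, and
likewise those of `√μ`, are bounded by those of `√γ`. The root of the first term is therefore
harmless, since `√f = min(√μ, √ν)`.

The difficulty is the second term: `√f_B` need not be regular. Strong positivity survives the
averaging and gives `Pγ ≥ β ν(t) R(y)` (`ae_mul_le_proj`). The increment of `f_B h` is at most `K R
(|Δ√ν| + |Δ√f|)` times the sum of the two values of `√ν`. Dividing by the sum of the two values of
`√Pγ`, which is at least `√(β R)` times the same sum, leaves `K √(R/β) (|Δ√ν| + |Δ√f|)`, whose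
square is integrable with the right bound because `∫ R = 1` (`lintegral_sqrt_proj_sub_le`).

The marginal statements follow from `γ_{B,A}` having marginals `ν` and `μ`: the second cancels the
weights `1/μ`, the first produces `ν`. -/

namespace SobPres

set_option linter.unusedSectionVars false

/-! ### H¹ regularity through L² estimates of translates -/

section Translation

variable {X : Type*} [NormedAddCommGroup X] [NormedSpace ℝ X] [FiniteDimensional ℝ X]
  [MeasureSpace X] [BorelSpace X] [(volume : Measure X).IsAddHaarMeasure]

/-- The `L²` distance between `u` and its translates by `s • v` is at most linear in `s`. -/
def TranslationLipschitz (u : X → ℝ) (v : X) : Prop :=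
  ∃ C : ℝ, 0 ≤ C ∧ ∀ s : ℝ,
    eLpNorm (fun x => u (x + s • v) - u x) 2 ≤ ENNReal.ofReal (C * |s|)

/-- The integral is the convolution of `u` with the reflected `φ`, evaluated at `r • v`; the
derivative falls on the smooth factor, so local integrability of `u` is enough. -/
lemma hasDerivAt_integral_mul_translate {u φ : X → ℝ} (hu : LocallyIntegrable u)
    (hφ : ContDiff ℝ ∞ φ) (hc : HasCompactSupport φ) (v : X) (r : ℝ) :
    HasDerivAt (fun r : ℝ => ∫ x, u x * φ (x - r • v))
      (-∫ x, u x * fderiv ℝ φ (x - r • v) v) r := by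
  set ψ : X → ℝ := fun y => φ (-y) with hψ
  have hψs : ContDiff ℝ 1 ψ := (hφ.of_le (by simp)).comp contDiff_neg
  have hψc : HasCompactSupport ψ := hc.comp_homeomorph (Homeomorph.neg X)
  have h1 := hψc.hasFDerivAt_convolution_right (ContinuousLinearMap.mul ℝ ℝ) hu hψs (r • v)
  have h2 : HasDerivAt (fun r : ℝ => r • v) v r := by
    simpa using (hasDerivAt_id r).smul_const v
  have h3 := h1.comp_hasDerivAt r h2
  have hd : ∀ y, fderiv ℝ ψ y v = - fderiv ℝ φ (-y) v := by
    intro y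
    have : HasFDerivAt ψ ((fderiv ℝ φ (-y)).comp (-ContinuousLinearMap.id ℝ X)) y :=
      ((hφ.differentiable (by simp)) (-y)).hasFDerivAt.comp y (hasFDerivAt_id y).neg
    rw [this.fderiv]
    simp
  rw [convolution_precompR_apply (ContinuousLinearMap.mul ℝ ℝ) hu (hψc.fderiv ℝ)
    (hψs.continuous_fderiv one_ne_zero)] at h3
  refine (h3.congr_deriv ?_).congr_of_eventuallyEq (Filter.Eventually.of_forall fun r => ?_)
  · simp [convolution_def, hd, integral_neg]
  · simp [convolution_def, hψ]

lemma memLp_of_contDiff {φ : X → ℝ} (hφ : ContDiff ℝ ∞ φ) (hc : HasCompactSupport φ) :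
    MemLp φ 2 := hφ.continuous.memLp_of_hasCompactSupport hc

lemma abs_integral_mul_le {u g : X → ℝ} (hu : MemLp u 2) (hg : MemLp g 2) :
    |∫ x, u x * g x| ≤ (eLpNorm u 2).toReal * (eLpNorm g 2).toReal := by
  have h := norm_inner_le_norm (𝕜 := ℝ) hg.toLp hu.toLp
  rw [L2.inner_def] at h
  have e : ∫ x, u x * g x = ∫ x, inner ℝ ((hg.toLp : Lp ℝ 2 volume) x) ((hu.toLp : Lp ℝ 2 volume) x) := by
    apply integral_congr_ae
    filter_upwards [hu.coeFn_toLp, hg.coeFn_toLp] with x h1 h2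
    simp [h1, h2]
  rw [e, ← Real.norm_eq_abs]
  simpa [Lp.norm_toLp, mul_comm] using h

/-- Test functions are dense in L², so the bound extends to all of L²; applied to `w` itself it
reads `‖w‖² ≤ C ‖w‖`. -/
lemma eLpNorm_le_of_forall_test {w : X → ℝ} (hw : MemLp w 2) {C : ℝ} (hC : 0 ≤ C)
    (h : ∀ φ : X → ℝ, ContDiff ℝ ∞ φ → HasCompactSupport φ →
      |∫ x, w x * φ x| ≤ C * (eLpNorm φ 2).toReal) :
    eLpNorm w 2 ≤ ENNReal.ofReal C := by
  have key : ∀ f : Lp ℝ 2 (volume : Measure X), |inner ℝ hw.toLp f| ≤ C * ‖f‖ := by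
    intro f
    refine (Lp.dense_hasCompactSupport_contDiff (F := ℝ) (μ := (volume : Measure X))
      (p := 2) (by simp)).induction (P := fun f => |inner ℝ hw.toLp f| ≤ C * ‖f‖) ?_
      (isClosed_le (by fun_prop) (by fun_prop)) f
    rintro f ⟨φ, hfφ, hc, hφ⟩
    have hf : f = (memLp_of_contDiff hφ hc).toLp := by
      apply Lp.ext
      exact hfφ.trans (memLp_of_contDiff hφ hc).coeFn_toLp.symm
    rw [hf, Lp.norm_toLp, L2.inner_def]
    refine le_trans (le_of_eq ?_) (h φ hφ hc)
    congr 1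
    apply integral_congr_ae
    filter_upwards [hw.coeFn_toLp, (memLp_of_contDiff hφ hc).coeFn_toLp] with x h1 h2
    simp [h1, h2, mul_comm]
  have h1 := key hw.toLp
  rw [real_inner_self_eq_norm_sq, abs_of_nonneg (by positivity)] at h1
  have h2 : ‖hw.toLp‖ ≤ C := by
    by_contra! h3
    nlinarith [norm_nonneg hw.toLp]
  rw [Lp.norm_toLp] at h2
  exact (ENNReal.le_ofReal_iff_toReal_le hw.eLpNorm_ne_top hC).2 h2

lemma memLp_comp_add {u : X → ℝ} (hu : MemLp u 2) (w : X) : MemLp (fun x => u (x + w)) 2 :=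
  hu.comp_measurePreserving (measurePreserving_add_right volume w)

lemma eLpNorm_comp_add {u : X → ℝ} (hu : AEStronglyMeasurable u) (w : X) :
    eLpNorm (fun x => u (x + w)) 2 = eLpNorm u 2 :=
  eLpNorm_comp_measurePreserving hu (measurePreserving_add_right volume w)

lemma integral_translate_sub_mul {u φ : X → ℝ} (hu : MemLp u 2)
    (hφ : ContDiff ℝ ∞ φ) (hc : HasCompactSupport φ) (w : X) :
    ∫ x, (u (x + w) - u x) * φ x = (∫ x, u x * φ (x - w)) - ∫ x, u x * φ x := by
  have hm := memLp_of_contDiff hφ hc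
  simp_rw [sub_mul]
  rw [integral_sub (f := fun x => u (x + w) * φ x) (g := fun x => u x * φ x)
    ((memLp_comp_add hu w).integrable_mul hm) (hu.integrable_mul hm)]
  congr 1
  rw [← integral_add_right_eq_self (fun x => u x * φ (x - w)) w]
  simp

/-- By duality the translation can be moved onto a test function. The derivative in `r` of `∫ u φ(·
- r v)` is `∫ g φ(· - r v)`, bounded by `‖g‖ ‖φ‖`, and the mean value inequality concludes with
constant `‖g‖₂`. -/
lemma TranslationLipschitz.of_isWeakDeriv {u g : X → ℝ} {v : X} (hu : MemLp u 2)
    (hg : MemLp g 2) (h : IsWeakDeriv u v g) : TranslationLipschitz u v := by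
  refine ⟨(eLpNorm g 2).toReal, by positivity, fun s => ?_⟩
  refine eLpNorm_le_of_forall_test ((memLp_comp_add hu _).sub hu) (by positivity) ?_
  intro φ hφ hc
  simp only [Pi.sub_apply]
  rw [integral_translate_sub_mul hu hφ hc]
  have hloc := hu.locallyIntegrable (by norm_num)
  have hd := fun r : ℝ => hasDerivAt_integral_mul_translate hloc hφ hc v r
  have hb : ∀ r : ℝ, ‖-∫ x, u x * fderiv ℝ φ (x - r • v) v‖ ≤
      (eLpNorm g 2).toReal * (eLpNorm φ 2).toReal := by
    intro r
    have e : -∫ x, u x * fderiv ℝ φ (x - r • v) v = ∫ x, g x * φ (x - r • v) := by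
      have h1 := h (fun x => φ (x - r • v)) (hφ.comp (contDiff_id.sub contDiff_const))
        (hc.comp_homeomorph (Homeomorph.subRight (r • v)))
      simp only [fderiv_comp_sub] at h1
      rw [h1, neg_neg]
    rw [e, Real.norm_eq_abs]
    have hm := memLp_of_contDiff hφ hc
    refine (abs_integral_mul_le hg (g := fun x => φ (x - r • v)) ?_).trans (le_of_eq ?_)
    · simpa [sub_eq_add_neg] using memLp_comp_add hm (-(r • v))
    · congr 2
      simpa [sub_eq_add_neg] using eLpNorm_comp_add hm.1 (-(r • v))
  have := Convex.norm_image_sub_le_of_norm_hasDerivWithin_le (s := Set.univ) (x := (0 : ℝ)) (y := s)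
    (fun r _ => (hd r).hasDerivWithinAt) (fun r _ => hb r) convex_univ trivial trivial
  simp only [zero_smul, sub_zero, Real.norm_eq_abs] at this
  linarith [this]

/-- Bounded difference quotients make `φ ↦ -∫ u ∂ᵥφ` bounded for the L² norm on test functions. It
extends to L² by density, and its Riesz representative is the weak derivative. -/
lemma TranslationLipschitz.exists_isWeakDeriv {u : X → ℝ} {v : X} (hu : MemLp u 2)
    (h : TranslationLipschitz u v) : ∃ g, MemLp g 2 ∧ IsWeakDeriv u v g := by
  obtain ⟨C, hC, h⟩ := h
  have hloc := hu.locallyIntegrable (by norm_num)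
  have bound : ∀ φ : X → ℝ, ContDiff ℝ ∞ φ → HasCompactSupport φ →
      |∫ x, u x * fderiv ℝ φ x v| ≤ C * (eLpNorm φ 2).toReal := by
    intro φ hφ hc
    have hd := hasDerivAt_integral_mul_translate hloc hφ hc v 0
    have hq : ∀ s : ℝ, |(∫ x, u x * φ (x - s • v)) - ∫ x, u x * φ x| ≤
        C * (eLpNorm φ 2).toReal * |s| := by
      intro s
      rw [← integral_translate_sub_mul hu hφ hc]
      refine (abs_integral_mul_le ((memLp_comp_add hu _).sub hu)
        (memLp_of_contDiff hφ hc)).trans ?_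
      rw [mul_right_comm]
      gcongr
      exact ENNReal.toReal_le_of_le_ofReal (by positivity) (h s)
    have := hd.le_of_lip' (C := C * (eLpNorm φ 2).toReal) (by positivity)
      (Filter.Eventually.of_forall fun s => by simpa using hq s)
    simpa using this
  let S : Submodule ℝ (X → ℝ) :=
    { carrier := {φ | ContDiff ℝ ∞ φ ∧ HasCompactSupport φ}
      add_mem' := fun h1 h2 => ⟨h1.1.add h2.1, h1.2.add h2.2⟩
      zero_mem' := ⟨contDiff_const, HasCompactSupport.zero⟩
      smul_mem' := fun c f hf => ⟨contDiff_const.smul hf.1, hf.2.smul_left (f := fun _ => c)⟩ }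
  have hS : ∀ φ : S, MemLp (φ : X → ℝ) 2 := fun φ => memLp_of_contDiff φ.2.1 φ.2.2
  let e : S →ₗ[ℝ] Lp ℝ 2 (volume : Measure X) :=
    { toFun := fun φ => (hS φ).toLp
      map_add' := fun φ ψ => MemLp.toLp_add (hS φ) (hS ψ)
      map_smul' := fun c φ => MemLp.toLp_const_smul c (hS φ) }
  have hint : ∀ φ : S, Integrable (fun x => u x * fderiv ℝ φ x v) := by
    intro φ
    have h1 : Continuous (fun x => fderiv ℝ (φ : X → ℝ) x v) :=
      (φ.2.1.continuous_fderiv (by simp)).clm_apply continuous_const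
    have h2 : HasCompactSupport (fun x => fderiv ℝ (φ : X → ℝ) x v) :=
      (φ.2.2.fderiv ℝ).comp_left (g := fun L : X →L[ℝ] ℝ => L v) (by simp)
    exact hu.integrable_mul (h1.memLp_of_hasCompactSupport (p := 2) h2)
  have hdiff : ∀ φ : S, ∀ x, DifferentiableAt ℝ (φ : X → ℝ) x := fun φ x =>
    (φ.2.1.differentiable (by simp)) x
  let l : S →ₗ[ℝ] ℝ :=
    { toFun := fun φ => -∫ x, u x * fderiv ℝ φ x v
      map_add' := fun φ ψ => by
        rw [← neg_add, ← integral_add (hint φ) (hint ψ)]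
        congr 2
        ext x
        rw [Submodule.coe_add, fderiv_add (hdiff φ x) (hdiff ψ x)]
        simp [mul_add]
      map_smul' := fun c φ => by
        simp only [RingHom.id_apply, smul_eq_mul]
        rw [mul_neg, ← integral_const_mul]
        congr 2
        ext x
        rw [Submodule.coe_smul, fderiv_const_smul (hdiff φ x)]
        simp only [_root_.smul_apply, smul_eq_mul]
        ring }
  have hdense : DenseRange e := by
    refine (Lp.dense_hasCompactSupport_contDiff (F := ℝ) (μ := (volume : Measure X))
      (p := 2) (by simp)).mono ?_
    rintro f ⟨φ, hfφ, hc, hφ⟩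
    refine ⟨⟨φ, hφ, hc⟩, ?_⟩
    apply Lp.ext
    exact (hS ⟨φ, hφ, hc⟩).coeFn_toLp.trans hfφ.symm
  have hbd : ∃ C, ∀ φ, ‖l φ‖ ≤ C * ‖e φ‖ := by
    refine ⟨C, fun φ => ?_⟩
    have := bound φ φ.2.1 φ.2.2
    simpa [l, e, Lp.norm_toLp] using this
  let L := l.extendOfNorm e
  let G := (InnerProductSpace.toDual ℝ (Lp ℝ 2 (volume : Measure X))).symm L
  refine ⟨G, Lp.memLp G, fun φ hφ hc => ?_⟩
  have h1 : inner ℝ G (e ⟨φ, hφ, hc⟩) = l ⟨φ, hφ, hc⟩ := by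
    rw [← LinearMap.extendOfNorm_eq (f := l) (e := e) hdense hbd]
    exact InnerProductSpace.toDual_symm_apply
  rw [L2.inner_def] at h1
  have h2 : ∫ x, (G : X → ℝ) x * φ x = l ⟨φ, hφ, hc⟩ := by
    rw [← h1]
    apply integral_congr_ae
    filter_upwards [(hS ⟨φ, hφ, hc⟩).coeFn_toLp] with x hx
    simp only [e, LinearMap.coe_mk, AddHom.coe_mk]
    rw [hx]
    simp [mul_comm]
  rw [h2]
  simp [l]

lemma TranslationLipschitz.add {u : X → ℝ} {v w : X} (hu : AEStronglyMeasurable u)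
    (hv : TranslationLipschitz u v) (hw : TranslationLipschitz u w) :
    TranslationLipschitz u (v + w) := by
  obtain ⟨C, hC, hv⟩ := hv
  obtain ⟨D, hD, hw⟩ := hw
  have hs : ∀ z, AEStronglyMeasurable (fun x => u (x + z)) := fun z =>
    hu.comp_measurePreserving (measurePreserving_add_right volume z)
  refine ⟨C + D, by positivity, fun s => ?_⟩
  have e : (fun x => u (x + s • (v + w)) - u x) =
      (fun x => u (x + s • w + s • v) - u (x + s • w)) + fun x => u (x + s • w) - u x := by
    ext x
    simp only [Pi.add_apply, smul_add]
    rw [add_comm (s • v), ← add_assoc]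
    ring
  have h1 : AEStronglyMeasurable (fun x => u (x + s • v) - u x) := (hs _).sub hu
  rw [e]
  refine (eLpNorm_add_le (h1.comp_measurePreserving
    (measurePreserving_add_right volume (s • w))) ((hs _).sub hu) (by norm_num)).trans ?_
  have e2 := eLpNorm_comp_add h1 (s • w)
  rw [add_mul, ENNReal.ofReal_add (by positivity) (by positivity)]
  exact add_le_add (e2.le.trans (hv s)) (hw s)

lemma TranslationLipschitz.sum {ι : Type*} {u : X → ℝ} (hu : AEStronglyMeasurable u)
    (s : Finset ι) (v : ι → X) (h : ∀ i, TranslationLipschitz u (v i)) :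
    TranslationLipschitz u (∑ i ∈ s, v i) := by
  classical
  induction s using Finset.induction_on with
  | empty => exact ⟨0, le_rfl, fun s => by simp⟩
  | insert i s hi ih => rw [Finset.sum_insert hi]; exact (h i).add hu ih

lemma MemH1.translationLipschitz {u : X → ℝ} (hu : MemH1 u) (v : X) :
    TranslationLipschitz u v := by
  obtain ⟨g, hg, h⟩ := hu.2 v
  exact .of_isWeakDeriv hu.1 hg h

end Translation

/-- Translation estimates add up along sums of directions, so it suffices to move one particle at a
time. -/
lemma memH1_of_translationLipschitz_single {N d : ℕ} {u : Conf N d → ℝ} (hu : MemLp u 2)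
    (h : ∀ (i : Fin N) (w : Pt d), TranslationLipschitz u (Pi.single i w)) : MemH1 u := by
  refine ⟨hu, fun v => ?_⟩
  refine TranslationLipschitz.exists_isWeakDeriv hu ?_
  rw [← Finset.univ_sum_single v]
  exact TranslationLipschitz.sum hu.1 _ _ fun i => h i (v i)

end SobPres

namespace SobPres

open ProbabilityTheory
open scoped ENNReal

/-! ### Product measures and kernels -/

section PiMeasures

/-- The masses need not be uniformly bounded (for `planBA` they are essentially `ν x`), so the
kernel is cut into finite kernels along the integer part of its mass. -/
lemma isSFiniteKernel_of_isFiniteMeasure {A B : Type*} [MeasurableSpace A] [MeasurableSpace B]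
    (κ : Kernel A B) [∀ a, IsFiniteMeasure (κ a)] : IsSFiniteKernel κ := by
  classical
  have hm : ∀ n : ℕ, MeasurableSet {a | ⌊(κ a Set.univ).toReal⌋₊ = n} := fun n =>
    (Nat.measurable_floor.comp (κ.measurable_coe MeasurableSet.univ).ennreal_toReal)
      (measurableSet_singleton n)
  refine ⟨fun n => Kernel.piecewise (hm n) κ 0, fun n => ⟨n + 1, by simp, fun a => ?_⟩, ?_⟩
  · rw [Kernel.piecewise_apply]
    split_ifs with h
    · rw [← ENNReal.ofReal_toReal (measure_ne_top (κ a) Set.univ)]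
      refine (ENNReal.ofReal_le_ofReal (Nat.lt_floor_add_one _).le).trans ?_
      rw [show ⌊(κ a Set.univ).toReal⌋₊ = n from h, ← Nat.cast_succ, ENNReal.ofReal_natCast]
      simp
    · simp
  · ext a s hs
    rw [Kernel.sum_apply' _ _ hs, tsum_eq_single ⌊(κ a Set.univ).toReal⌋₊]
    · rw [Kernel.piecewise_apply]
      simp
    · intro n hn
      rw [Kernel.piecewise_apply, if_neg (fun h => hn h.symm)]
      simp

lemma lintegral_fin_nat_prod {T : Type*} [MeasurableSpace T] (n : ℕ) (μ : Fin n → Measure T)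
    [∀ i, SigmaFinite (μ i)] (f : Fin n → T → ℝ≥0∞) (hf : ∀ i, Measurable (f i)) :
    ∫⁻ x, ∏ i, f i (x i) ∂(Measure.pi μ) = ∏ i, ∫⁻ x, f i x ∂(μ i) := by
  induction n with
  | zero => simp
  | succ n ih =>
    rw [← ((measurePreserving_piFinSuccAbove μ 0).symm).lintegral_comp_emb
      (MeasurableEquiv.measurableEmbedding _)]
    simp_rw [MeasurableEquiv.piFinSuccAbove_symm_apply, Fin.insertNthEquiv,
      Fin.prod_univ_succ, Fin.insertNth_zero, Equiv.coe_fn_mk, Fin.cons_succ,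
      Fin.zero_succAbove, Fin.cons_zero]
    have := ih (fun i => μ i.succ) (fun i => f i.succ) fun i => hf _
    rw [← this, ← lintegral_prod_mul (hf 0).aemeasurable]
    · rfl
    exact (Finset.measurable_fun_prod _ fun i _ => (hf _).comp (measurable_pi_apply i)).aemeasurable

lemma measurable_pi_comp {ι S T : Type*} [Fintype ι] [MeasurableSpace S] [MeasurableSpace T]
    {k : S → Measure T} [∀ x, IsFiniteMeasure (k x)] (hk : Measurable k) :
    Measurable fun x : ι → S => Measure.pi fun i => k (x i) := by
  have h : ∀ s : ι → Set T, (∀ i, MeasurableSet (s i)) →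
      Measurable fun x : ι → S => (Measure.pi fun i => k (x i)) (Set.univ.pi s) := by
    intro s hs
    simp_rw [Measure.pi_pi]
    exact Finset.measurable_fun_prod _ fun i _ =>
      ((Measure.measurable_coe (hs i)).comp hk).comp (measurable_pi_apply i)
  refine Measurable.measure_of_isPiSystem generateFrom_pi.symm isPiSystem_pi ?_ ?_
  · rintro _ ⟨s, hs, rfl⟩
    exact h s fun i => hs i trivial
  · simpa using h (fun _ => Set.univ) fun _ => MeasurableSet.univ

/-- Both sides agree on boxes, where the integrand is a product of functions of one coordinate. -/
lemma pi_bind_pi {S T : Type*} [MeasurableSpace S] [MeasurableSpace T] (n : ℕ)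
    (μ : Measure S) [SigmaFinite μ] {k : S → Measure T} [∀ x, IsFiniteMeasure (k x)]
    (hk : Measurable k) [SigmaFinite (μ.bind k)] :
    (Measure.pi fun _ : Fin n => μ).bind (fun x => Measure.pi fun i => k (x i)) =
      Measure.pi fun _ : Fin n => μ.bind k := by
  refine (Measure.pi_eq fun s hs => ?_).symm
  rw [Measure.bind_apply (MeasurableSet.univ_pi hs) (measurable_pi_comp hk).aemeasurable]
  simp_rw [Measure.pi_pi]
  rw [lintegral_fin_nat_prod n (fun _ => μ) (fun i x => k x (s i))
    fun i => (Measure.measurable_coe (hs i)).comp hk]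
  refine Finset.prod_congr rfl fun i _ => ?_
  rw [Measure.bind_apply (hs i) hk.aemeasurable]

lemma pi_withDensity {T : Type*} [MeasurableSpace T] (n : ℕ) (μ : Measure T) [SigmaFinite μ]
    {g : T → ℝ≥0∞} (hg : Measurable g) [SigmaFinite (μ.withDensity g)] :
    (Measure.pi fun _ : Fin n => μ.withDensity g) =
      (Measure.pi fun _ : Fin n => μ).withDensity fun x => ∏ i, g (x i) := by
  refine Measure.pi_eq fun s hs => ?_
  rw [withDensity_apply _ (MeasurableSet.univ_pi hs),
    ← lintegral_indicator (MeasurableSet.univ_pi hs)]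
  have e : (Set.univ.pi s).indicator (fun x : Fin n → T => ∏ i, g (x i)) =
      fun x => ∏ i, (s i).indicator g (x i) := by
    ext x
    by_cases hx : x ∈ Set.univ.pi s
    · rw [Set.indicator_of_mem hx]
      exact Finset.prod_congr rfl fun i _ => (Set.indicator_of_mem (hx i trivial) _).symm
    · rw [Set.indicator_of_notMem hx]
      simp only [Set.mem_pi, Set.mem_univ, true_implies, not_forall] at hx
      obtain ⟨i, hi⟩ := hx
      exact (Finset.prod_eq_zero (Finset.mem_univ i) (Set.indicator_of_notMem hi _)).symm
  rw [e, lintegral_fin_nat_prod n (fun _ => μ) (fun i => (s i).indicator g)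
    fun i => hg.indicator (hs i)]
  refine Finset.prod_congr rfl fun i _ => ?_
  rw [withDensity_apply _ (hs i), lintegral_indicator (hs i)]

end PiMeasures

/-! ### Marginals of the plan and of its products -/

section Plan

variable {d : ℕ} {μ ν : Pt d → ℝ}

lemma common_comm (μ ν : Pt d → ℝ) : common μ ν = common ν μ := by
  ext x; exact min_comm _ _

lemma excess_nonneg (μ ν : Pt d → ℝ) (x : Pt d) : 0 ≤ excess μ ν x := le_max_right _ _

lemma excess_eq (μ ν : Pt d → ℝ) (x : Pt d) : excess μ ν x = μ x - common μ ν x :=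
  max_eq_left (sub_nonneg.2 (min_le_left _ _))

lemma common_nonneg (hμ : ∀ x, 0 ≤ μ x) (hν : ∀ x, 0 ≤ ν x) (x : Pt d) : 0 ≤ common μ ν x :=
  le_min (hμ x) (hν x)

lemma measurable_common (hμ : Measurable μ) (hν : Measurable ν) : Measurable (common μ ν) :=
  hμ.min hν

lemma measurable_excess (hμ : Measurable μ) (hν : Measurable ν) : Measurable (excess μ ν) :=
  (hμ.sub (measurable_common hμ hν)).max measurable_const

lemma integrable_common (hμ : Integrable μ) (hν : Integrable ν) : Integrable (common μ ν) :=
  hμ.inf hν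

lemma integrable_excess (hμ : Integrable μ) (hν : Integrable ν) : Integrable (excess μ ν) :=
  (hμ.sub (integrable_common hμ hν)).pos_part

lemma integral_excess_comm (hμ : Integrable μ) (hν : Integrable ν)
    (h : ∫ x, μ x = ∫ x, ν x) : ∫ x, excess μ ν x = ∫ x, excess ν μ x := by
  simp_rw [excess_eq]
  rw [integral_sub hμ (integrable_common hμ hν), integral_sub hν (integrable_common hν hμ), h,
    common_comm]

lemma lintegral_excess (hμ : Integrable μ) (hν : Integrable ν) :
    ∫⁻ x, ENNReal.ofReal (excess μ ν x) = ENNReal.ofReal (∫ x, excess μ ν x) :=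
  (ofReal_integral_eq_lintegral_ofReal (integrable_excess hμ hν)
    (Filter.Eventually.of_forall (excess_nonneg μ ν))).symm

lemma integral_excess_nonneg (μ ν : Pt d → ℝ) : 0 ≤ ∫ x, excess μ ν x :=
  integral_nonneg (excess_nonneg μ ν)

lemma isFiniteMeasure_planBA (hμ : Integrable μ) (hν : Integrable ν) (x : Pt d) :
    IsFiniteMeasure (planBA μ ν x) := by
  have h1 : IsFiniteMeasure (volume.withDensity fun x' => ENNReal.ofReal (excess μ ν x')) :=
    isFiniteMeasure_withDensity_ofReal (integrable_excess hμ hν).2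
  have h2 := Measure.smul_finite (volume.withDensity fun x' => ENNReal.ofReal (excess μ ν x'))
    (ENNReal.ofReal_ne_top (r := excess ν μ x / ∫ z, excess ν μ z))
  have h3 := Measure.smul_finite (Measure.dirac x) (ENNReal.ofReal_ne_top (r := common μ ν x))
  rw [planBA]
  infer_instance

lemma lintegral_planBA (hμ : Measurable μ) (hν : Measurable ν) (x : Pt d)
    {F : Pt d → ℝ≥0∞} (hF : Measurable F) :
    ∫⁻ x', F x' ∂(planBA μ ν x) = ENNReal.ofReal (common μ ν x) * F x +
      ENNReal.ofReal (excess ν μ x / ∫ z, excess ν μ z) *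
        ∫⁻ x', ENNReal.ofReal (excess μ ν x') * F x' := by
  rw [planBA, lintegral_add_measure, lintegral_smul_measure, lintegral_smul_measure,
    lintegral_dirac' _ hF,
    lintegral_withDensity_eq_lintegral_mul _ (measurable_excess hμ hν).ennreal_ofReal hF]
  rfl

lemma measurable_planBA (hμ : Measurable μ) (hν : Measurable ν) : Measurable (planBA μ ν) := by
  refine Measure.measurable_of_measurable_coe _ fun s hs => ?_
  simp_rw [planBA, Measure.add_apply, Measure.smul_apply, Measure.dirac_apply' _ hs, smul_eq_mul]
  refine Measurable.add (Measurable.mul ?_ ?_) (Measurable.mul_const ?_ _)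
  · exact (measurable_common hμ hν).ennreal_ofReal
  · exact measurable_one.indicator hs
  · exact ((measurable_excess hν hμ).div_const _).ennreal_ofReal

lemma ae_excess_eq_zero (hμ : Integrable μ) (hν : Integrable ν)
    (h : ∫ x, excess μ ν x = 0) : ∀ᵐ x, excess μ ν x = 0 :=
  (integral_eq_zero_iff_of_nonneg (excess_nonneg μ ν) (integrable_excess hμ hν)).1 h

/-- Normalising `f_B` makes the first factor `1`. In the degenerate case `∫ f_B = 0` the quotient is
`0`, but then `∫ f_A = 0` as well and both sides vanish. -/
lemma lintegral_excess_div_mul (hμ : Integrable μ) (hν : Integrable ν)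
    (h : ∫ x, μ x = ∫ x, ν x) (F : Pt d → ℝ≥0∞) :
    (∫⁻ x, ENNReal.ofReal (excess ν μ x / ∫ z, excess ν μ z)) *
      (∫⁻ x, ENNReal.ofReal (excess μ ν x) * F x) =
      ∫⁻ x, ENNReal.ofReal (excess μ ν x) * F x := by
  rcases (integral_excess_nonneg ν μ).eq_or_lt with h0 | h0
  · have h1 : ∀ᵐ x, excess μ ν x = 0 := ae_excess_eq_zero hμ hν
      ((integral_excess_comm hμ hν h).trans h0.symm)
    have h2 : ∫⁻ x, ENNReal.ofReal (excess μ ν x) * F x = 0 := by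
      rw [← lintegral_zero (μ := (volume : Measure (Pt d)))]
      refine lintegral_congr_ae ?_
      filter_upwards [h1] with x hx
      simp [hx]
    rw [h2, mul_zero]
  · have h1 : ∫⁻ x, ENNReal.ofReal (excess ν μ x / ∫ z, excess ν μ z) = 1 := by
      rw [← ofReal_integral_eq_lintegral_ofReal ((integrable_excess hν hμ).div_const _)
        (Filter.Eventually.of_forall fun x => div_nonneg (excess_nonneg ν μ x) h0.le),
        integral_div, div_self h0.ne', ENNReal.ofReal_one]
    rw [h1, one_mul]

lemma ofReal_common_add_excess (hμ : ∀ x, 0 ≤ μ x) (hν : ∀ x, 0 ≤ ν x) (x : Pt d) :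
    ENNReal.ofReal (common μ ν x) + ENNReal.ofReal (excess μ ν x) = ENNReal.ofReal (μ x) := by
  rw [← ENNReal.ofReal_add (common_nonneg hμ hν x) (excess_nonneg μ ν x), excess_eq]
  ring_nf

/-- This is the second marginal of the plan: `f + f_A = μ`. -/
lemma bind_planBA (hμm : Measurable μ) (hνm : Measurable ν) (hμ0 : ∀ x, 0 ≤ μ x)
    (hν0 : ∀ x, 0 ≤ ν x) (hμ : Integrable μ) (hν : Integrable ν) (h : ∫ x, μ x = ∫ x, ν x) :
    (volume : Measure (Pt d)).bind (planBA μ ν) =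
      volume.withDensity fun x => ENNReal.ofReal (μ x) := by
  have hc := (measurable_common hμm hνm).ennreal_ofReal
  refine Measure.ext_of_lintegral _ fun F hF => ?_
  rw [Measure.lintegral_bind (measurable_planBA hμm hνm).aemeasurable hF.aemeasurable]
  simp_rw [lintegral_planBA hμm hνm _ hF]
  have hcF : Measurable fun x => ENNReal.ofReal (common μ ν x) * F x := hc.mul hF
  rw [lintegral_add_left hcF, lintegral_mul_const _
    ((measurable_excess hνm hμm).div_const _).ennreal_ofReal,
    lintegral_excess_div_mul hμ hν h, ← lintegral_add_left hcF,
    lintegral_withDensity_eq_lintegral_mul _ hμm.ennreal_ofReal hF]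
  refine lintegral_congr fun x => ?_
  simp only [Pi.mul_apply]
  rw [← add_mul, ofReal_common_add_excess hμ0 hν0]

/-- This is the first marginal: `f + f_B = ν`. It holds only almost everywhere because, when `∫ f_B
= 0`, the excess `f_B` may be nonzero on a null set where the plan ignores it. -/
lemma planBA_univ (hμm : Measurable μ) (hνm : Measurable ν) (hμ0 : ∀ x, 0 ≤ μ x)
    (hν0 : ∀ x, 0 ≤ ν x) (hμ : Integrable μ) (hν : Integrable ν) (h : ∫ x, μ x = ∫ x, ν x) :
    ∀ᵐ x, planBA μ ν x Set.univ = ENNReal.ofReal (ν x) := by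
  have e : ∀ x, planBA μ ν x Set.univ = ENNReal.ofReal (common μ ν x) +
      ENNReal.ofReal (excess ν μ x / ∫ z, excess ν μ z) *
        ENNReal.ofReal (∫ z, excess ν μ z) := by
    intro x
    rw [← lintegral_one, lintegral_planBA hμm hνm x measurable_const]
    simp only [mul_one]
    rw [lintegral_excess hμ hν, integral_excess_comm hμ hν h]
  rcases (integral_excess_nonneg ν μ).eq_or_lt with h0 | h0
  · filter_upwards [ae_excess_eq_zero hν hμ h0.symm] with x hx
    rw [e, ← ofReal_common_add_excess hν0 hμ0, hx, common_comm]
    simp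
  · filter_upwards with x
    rw [e, ← ENNReal.ofReal_mul (div_nonneg (excess_nonneg ν μ x) h0.le), div_mul_cancel₀ _ h0.ne',
      common_comm, ofReal_common_add_excess hν0 hμ0]

/-- Both `f` and `f_A` are dominated by `μ`, so the plan does not charge `{μ = 0}` and the
convention for `1/μ` there is harmless. -/
lemma ae_planBA_ne_zero (hμm : Measurable μ) (hνm : Measurable ν) (hμ0 : ∀ x, 0 ≤ μ x)
    (hν0 : ∀ x, 0 ≤ ν x) (x : Pt d) : ∀ᵐ x' ∂(planBA μ ν x), μ x' ≠ 0 := by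
  rw [ae_iff]
  simp only [not_not]
  have hs : MeasurableSet {x | μ x = 0} := hμm (measurableSet_singleton 0)
  rw [← lintegral_indicator_one hs, lintegral_planBA hμm hνm x (measurable_one.indicator hs)]
  have h1 : ∀ x, common μ ν x ≤ μ x := fun x => min_le_left _ _
  have h2 : ∀ x, excess μ ν x ≤ μ x := fun x => by
    rw [excess_eq]; linarith [common_nonneg hμ0 hν0 x]
  have key : ∀ f : Pt d → ℝ, (∀ x, f x ≤ μ x) → ∀ x,
      ENNReal.ofReal (f x) * ({x | μ x = 0}.indicator (1 : Pt d → ℝ≥0∞) x) = 0 := by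
    intro f hf x
    by_cases hx : μ x = 0
    · simp [ENNReal.ofReal_eq_zero.2 ((hf x).trans hx.le)]
    · simp [hx]
  simp only [key _ h1, key _ h2, lintegral_zero, mul_zero, add_zero]

lemma ofReal_inv_mul_ofReal {a : ℝ} (h : 0 ≤ a) :
    ENNReal.ofReal a⁻¹ * ENNReal.ofReal a = if a = 0 then 0 else 1 := by
  split_ifs with h0
  · simp [h0]
  · rw [← ENNReal.ofReal_mul (inv_nonneg.2 h), inv_mul_cancel₀ h0, ENNReal.ofReal_one]

/-- The product plan on configurations. -/
noncomputable def planPi {N d : ℕ} (μ ν : Pt d → ℝ) (x : Conf N d) : Measure (Conf N d) :=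
  Measure.pi fun i => planBA μ ν (x i)

/-- The weight `∏ᵢ 1 / μ (xᵢ)`. -/
noncomputable def weight {N d : ℕ} (μ : Pt d → ℝ) (x : Conf N d) : ℝ≥0∞ :=
  ENNReal.ofReal (∏ i, (μ (x i))⁻¹)

lemma measurable_weight {N : ℕ} (hμm : Measurable μ) :
    Measurable (weight μ : Conf N d → ℝ≥0∞) :=
  (Finset.measurable_fun_prod _ fun i _ =>
    (hμm.comp (measurable_pi_apply i)).inv).ennreal_ofReal

lemma measurable_planPi {N : ℕ} (hμm : Measurable μ) (hνm : Measurable ν)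
    (hμ : Integrable μ) (hν : Integrable ν) :
    Measurable (planPi μ ν : Conf N d → Measure (Conf N d)) := by
  have := isFiniteMeasure_planBA hμ hν
  exact measurable_pi_comp (measurable_planBA hμm hνm)

lemma isFiniteMeasure_planPi {N : ℕ} (hμ : Integrable μ) (hν : Integrable ν) (x : Conf N d) :
    IsFiniteMeasure (planPi μ ν x) := by
  have := isFiniteMeasure_planBA hμ hν
  rw [planPi]
  infer_instance

lemma bind_planPi {N : ℕ} (hμm : Measurable μ) (hνm : Measurable ν) (hμ0 : ∀ x, 0 ≤ μ x)
    (hν0 : ∀ x, 0 ≤ ν x) (hμ : Integrable μ) (hν : Integrable ν) (h : ∫ x, μ x = ∫ x, ν x) :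
    (volume : Measure (Conf N d)).bind (planPi μ ν) =
      volume.withDensity fun x => ∏ i, ENNReal.ofReal (μ (x i)) := by
  have := isFiniteMeasure_planBA hμ hν
  have e := bind_planBA hμm hνm hμ0 hν0 hμ hν h
  have hfin : IsFiniteMeasure (volume.withDensity fun x => ENNReal.ofReal (μ x)) :=
    isFiniteMeasure_withDensity_ofReal hμ.2
  have hs : SigmaFinite ((volume : Measure (Pt d)).bind (planBA μ ν)) := by
    rw [e]; infer_instance
  have h1 := pi_bind_pi N (volume : Measure (Pt d)) (measurable_planBA hμm hνm)
  simp_rw [e] at h1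
  rw [pi_withDensity N volume hμm.ennreal_ofReal] at h1
  exact h1

lemma weight_mul_prod {N : ℕ} (hμ0 : ∀ x, 0 ≤ μ x) (x : Conf N d) :
    weight μ x * ∏ i, ENNReal.ofReal (μ (x i)) = if ∃ i, μ (x i) = 0 then 0 else 1 := by
  rw [weight, ENNReal.ofReal_prod_of_nonneg fun i _ => inv_nonneg.2 (hμ0 _),
    ← Finset.prod_mul_distrib]
  simp_rw [ofReal_inv_mul_ofReal (hμ0 _)]
  split_ifs with h
  · obtain ⟨i, hi⟩ := h
    exact Finset.prod_eq_zero (Finset.mem_univ i) (if_pos hi)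
  · push Not at h
    exact Finset.prod_eq_one fun i _ => if_neg (h i)

/-- Integrating over `x` first replaces the plan by its second marginal, with density `∏ μ(xᵢ)`,
which cancels the weight wherever no factor vanishes. -/
lemma lintegral_lintegral_planPi {N : ℕ} (hμm : Measurable μ) (hνm : Measurable ν)
    (hμ0 : ∀ x, 0 ≤ μ x) (hν0 : ∀ x, 0 ≤ ν x) (hμ : Integrable μ) (hν : Integrable ν)
    (h : ∫ x, μ x = ∫ x, ν x) {F : Conf N d → ℝ≥0∞} (hF : Measurable F) :
    ∫⁻ x, ∫⁻ x', weight μ x' * F x' ∂(planPi μ ν x) =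
      ∫⁻ x, (weight μ x * ∏ i, ENNReal.ofReal (μ (x i))) * F x := by
  have hm : Measurable fun x : Conf N d => weight μ x * F x := (measurable_weight hμm).mul hF
  rw [← Measure.lintegral_bind (f := fun x' => weight μ x' * F x')
    (measurable_planPi hμm hνm hμ hν).aemeasurable hm.aemeasurable,
    bind_planPi hμm hνm hμ0 hν0 hμ hν h, lintegral_withDensity_eq_lintegral_mul _ ?_ hm]
  · refine lintegral_congr fun x => ?_
    simp only [Pi.mul_apply]
    ring
  · exact Finset.measurable_fun_prod _ fun i _ =>
      (hμm.comp (measurable_pi_apply i)).ennreal_ofReal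

lemma lintegral_lintegral_planPi_le {N : ℕ} (hμm : Measurable μ) (hνm : Measurable ν)
    (hμ0 : ∀ x, 0 ≤ μ x) (hν0 : ∀ x, 0 ≤ ν x) (hμ : Integrable μ) (hν : Integrable ν)
    (h : ∫ x, μ x = ∫ x, ν x) {F : Conf N d → ℝ≥0∞} (hF : Measurable F) :
    ∫⁻ x, ∫⁻ x', weight μ x' * F x' ∂(planPi μ ν x) ≤ ∫⁻ x, F x := by
  rw [lintegral_lintegral_planPi hμm hνm hμ0 hν0 hμ hν h hF]
  refine lintegral_mono fun x => ?_
  rw [weight_mul_prod hμ0]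
  split_ifs <;> simp

lemma lintegral_lintegral_planPi_eq {N : ℕ} (hμm : Measurable μ) (hνm : Measurable ν)
    (hμ0 : ∀ x, 0 ≤ μ x) (hν0 : ∀ x, 0 ≤ ν x) (hμ : Integrable μ) (hν : Integrable ν)
    (h : ∫ x, μ x = ∫ x, ν x) {F : Conf N d → ℝ≥0∞} (hF : Measurable F)
    (hF0 : ∀ᵐ x, ∀ i, μ (x i) = 0 → F x = 0) :
    ∫⁻ x, ∫⁻ x', weight μ x' * F x' ∂(planPi μ ν x) = ∫⁻ x, F x := by
  rw [lintegral_lintegral_planPi hμm hνm hμ0 hν0 hμ hν h hF]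
  refine lintegral_congr_ae ?_
  filter_upwards [hF0] with x hx
  rw [weight_mul_prod hμ0]
  split_ifs with h
  · obtain ⟨i, hi⟩ := h
    rw [hx i hi, mul_zero]
  · rw [one_mul]

/-- The plans have atoms, so a Lebesgue null set may be charged by an individual one; absolute
continuity of the second marginal excludes this for almost every `x`. -/
lemma ae_ae_planPi {N : ℕ} (hμm : Measurable μ) (hνm : Measurable ν) (hμ0 : ∀ x, 0 ≤ μ x)
    (hν0 : ∀ x, 0 ≤ ν x) (hμ : Integrable μ) (hν : Integrable ν) (h : ∫ x, μ x = ∫ x, ν x)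
    {p : Conf N d → Prop} (hp : ∀ᵐ x, p x) : ∀ᵐ x, ∀ᵐ x' ∂(planPi μ ν x), p x' := by
  refine Measure.ae_ae_of_ae_bind (measurable_planPi hμm hνm hμ hν).aemeasurable ?_
  rw [bind_planPi hμm hνm hμ0 hν0 hμ hν h]
  exact (withDensity_absolutelyContinuous _ _).ae_le hp

end Plan

end SobPres

namespace SobPres

open scoped ENNReal

/-! ### Pointwise inequalities for increments of square roots -/

section Pointwise

/-- With `p = √(F + B)`, factor `(p' - p)(p' + p) = (F' - F) + (B' - B)` and divide by `p' + p ≥ √F'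
+ √F`. Only `F` has its root compared; `B` enters through its plain increment. -/
lemma abs_sqrt_add_sub_sqrt_add_le {F F' B B' E : ℝ} (hF : 0 ≤ F) (hF' : 0 ≤ F') (hB : 0 ≤ B)
    (hB' : 0 ≤ B') (hE : 0 ≤ E) (h : |B' - B| ≤ E * (√(F' + B') + √(F + B))) :
    |√(F' + B') - √(F + B)| ≤ |√F' - √F| + E := by
  have e1 := Real.sq_sqrt hF
  have e1' := Real.sq_sqrt hF'
  have e2 := Real.sq_sqrt (add_nonneg hF hB)
  have e2' := Real.sq_sqrt (add_nonneg hF' hB')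
  have l : √F ≤ √(F + B) := Real.sqrt_le_sqrt (by linarith)
  have l' : √F' ≤ √(F' + B') := Real.sqrt_le_sqrt (by linarith)
  set f := √F
  set f' := √F'
  set p := √(F + B)
  set p' := √(F' + B')
  have hf : 0 ≤ f := Real.sqrt_nonneg _
  have hf' : 0 ≤ f' := Real.sqrt_nonneg _
  rcases (add_nonneg (hf'.trans l') (hf.trans l)).eq_or_lt with h0 | h0
  · have h1 : p' = 0 := by linarith
    have h2 : p = 0 := by linarith
    rw [h1, h2, sub_zero, abs_zero]
    positivity
  · refine le_of_mul_le_mul_right ?_ h0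
    have h3 : |p' - p| * (p' + p) = |(f' - f) * (f' + f) + (B' - B)| := by
      have e : (f' - f) * (f' + f) + (B' - B) = (p' - p) * (p' + p) := by
        linear_combination e1' - e1 - e2' + e2
      rw [e, abs_mul, abs_of_pos h0]
    rw [h3]
    refine (abs_add_le _ _).trans ?_
    rw [abs_mul, abs_of_nonneg (add_nonneg hf' hf), add_mul]
    have : |f' - f| * (f' + f) ≤ |f' - f| * (p' + p) := by gcongr
    linarith

lemma abs_min_sub_min_sq_le (a a' b b' : ℝ) :
    |min a' b' - min a b| ^ 2 ≤ (a' - a) ^ 2 + (b' - b) ^ 2 := by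
  have h := abs_min_sub_min_le_max a' b' a b
  have h1 : |min a' b' - min a b| ^ 2 ≤ (max |a' - a| |b' - b|) ^ 2 :=
    pow_le_pow_left₀ (abs_nonneg _) h 2
  refine h1.trans ?_
  rcases max_cases |a' - a| |b' - b| with ⟨e, _⟩ | ⟨e, _⟩ <;> rw [e, sq_abs] <;>
    nlinarith [sq_nonneg (a' - a), sq_nonneg (b' - b)]

/-- Here `a`, `b`, `g` stand for `√μ`, `√ν`, `√G`. Splitting off the increment of the minimum and
using `min a b ≤ a` to cancel the denominator leaves only the quotient `g' / a'` at the translated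
point, which is square integrable in the other coordinates. -/
lemma abs_min_div_mul_sub_le {a a' b b' g g' : ℝ} (ha : 0 ≤ a) (ha' : 0 ≤ a') (hb : 0 ≤ b)
    (hg' : 0 ≤ g') (h0 : a' = 0 → g' = 0) :
    |min a' b' / a' * g' - min a b / a * g| ≤
      (|min a' b' - min a b| + |a' - a|) * (g' / a') + |g' - g| := by
  set φ := min a b
  set φ' := min a' b'
  have hφ : 0 ≤ φ := le_min ha hb
  have hφa : φ ≤ a := min_le_left _ _
  have hq : 0 ≤ g' / a' := div_nonneg hg' ha'
  have hga : a' * (g' / a') = g' := by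
    by_cases h : a' = 0
    · rw [h0 h, zero_div, mul_zero]
    · field_simp
  have e : φ' / a' * g' - φ / a * g = (φ' - φ) * (g' / a') + φ * (g' / a' - g / a) := by ring
  have h2 : |φ * (g' / a' - g / a)| ≤ |a' - a| * (g' / a') + |g' - g| := by
    rw [abs_mul, abs_of_nonneg hφ]
    refine (mul_le_mul_of_nonneg_right hφa (abs_nonneg _)).trans ?_
    rcases ha.eq_or_lt with h | h
    · rw [← h, zero_mul]
      positivity
    · rw [← abs_of_nonneg ha, ← abs_mul, abs_of_nonneg ha]
      have e2 : a * (g' / a' - g / a) = (a - a') * (g' / a') + (g' - g) := by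
        have : a * (g / a) = g := by field_simp
        linear_combination hga - this
      rw [e2]
      refine (abs_add_le _ _).trans ?_
      rw [abs_mul, abs_of_nonneg hq, abs_sub_comm]
  rw [e]
  refine (abs_add_le _ _).trans ?_
  rw [abs_mul, abs_of_nonneg hq, add_mul, add_assoc]
  gcongr

/-- The differences of squares produce a factor `b' + b`, and the lower bounds on `p` and `p'`
absorb it together with one factor `√R`. This is where strong positivity acts. -/
lemma abs_sq_sub_sq_mul_sub_le {b b' φ φ' h R K β p p' : ℝ} (hb : 0 ≤ b) (hb' : 0 ≤ b')
    (hφ : 0 ≤ φ) (hφ' : 0 ≤ φ') (hφb : φ ≤ b) (hφb' : φ' ≤ b') (hh : 0 ≤ h) (hR : 0 ≤ R)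
    (hK : 0 ≤ K) (hβ : 0 < β) (hhR : h ≤ K * R) (hp : √β * √R * b ≤ p)
    (hp' : √β * √R * b' ≤ p') :
    |(b' ^ 2 - φ' ^ 2) * h - (b ^ 2 - φ ^ 2) * h| ≤
      K * √R / √β * (|b' - b| + |φ' - φ|) * (p' + p) := by
  have e1 : (b' ^ 2 - φ' ^ 2) * h - (b ^ 2 - φ ^ 2) * h =
      ((b' - b) * (b' + b) - (φ' - φ) * (φ' + φ)) * h := by ring
  have e2 : |(b' - b) * (b' + b) - (φ' - φ) * (φ' + φ)| ≤
      (|b' - b| + |φ' - φ|) * (b' + b) := by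
    refine (abs_sub _ _).trans ?_
    rw [abs_mul, abs_mul, abs_of_nonneg (add_nonneg hb' hb),
      abs_of_nonneg (add_nonneg hφ' hφ), add_mul]
    gcongr
  rw [e1, abs_mul, abs_of_nonneg hh]
  calc _ ≤ (|b' - b| + |φ' - φ|) * (b' + b) * (K * R) := by gcongr
    _ = K * √R / √β * (|b' - b| + |φ' - φ|) * (√β * √R * b' + √β * √R * b) := by
      have h1 : √β ≠ 0 := (Real.sqrt_pos.2 hβ).ne'
      have h2 : R = √R * √R := (Real.mul_self_sqrt hR).symm
      generalize √R = r at *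
      subst h2
      field_simp
    _ ≤ _ := by gcongr

/-- The `3` comes from squaring three terms, each `4` from a sum of two increments whose squares are
at most `D`. -/
lemma sq_add_add_le {u v c x y z r K β D q : ℝ} (hr : 0 ≤ r) (hq : 0 ≤ q) (hβ : 0 < β)
    (hu : u ^ 2 ≤ D) (hv : v ^ 2 ≤ D) (hc : c ^ 2 ≤ D) (hx : x ^ 2 = q)
    (hz : z = K * √r / √β * (v + c)) :
    ((c + u) * x + y + z) ^ 2 ≤ 3 * (y ^ 2 + D * (4 * q + 4 * K ^ 2 / β * r)) := by
  have two : ∀ s t : ℝ, s ^ 2 ≤ D → t ^ 2 ≤ D → (s + t) ^ 2 ≤ 4 * D := fun s t hs ht => by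
    linarith only [hs, ht, sq_nonneg (s - t)]
  have t1 : ((c + u) * x) ^ 2 ≤ D * (4 * q) := by
    rw [mul_pow, hx]
    calc _ ≤ 4 * D * q := by gcongr; exact two c u hc hu
      _ = _ := by ring
  have t3 : z ^ 2 ≤ D * (4 * K ^ 2 / β * r) := by
    rw [hz, mul_pow, div_pow, mul_pow, Real.sq_sqrt hr, Real.sq_sqrt hβ.le]
    calc _ ≤ K ^ 2 * r / β * (4 * D) := by gcongr; exact two v c hv hc
      _ = _ := by ring
  generalize (c + u) * x = X at *
  linarith only [t1, t3, sq_nonneg (X - y), sq_nonneg (X - z), sq_nonneg (y - z)]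

lemma abs_sqrt_proj_sub_le {a a' b b' φ φ' G G' h R K β : ℝ} (hb : 0 ≤ b) (hb' : 0 ≤ b')
    (ha : 0 ≤ a) (ha' : 0 ≤ a') (hφ : 0 ≤ φ) (hφ' : 0 ≤ φ') (hφb : φ ≤ b) (hφb' : φ' ≤ b')
    (hG : 0 ≤ G) (hG' : 0 ≤ G') (hh : 0 ≤ h) (hR : 0 ≤ R) (hK : 0 ≤ K)
    (hβ : 0 < β) (hhR : h ≤ K * R)
    (hP : β * b ^ 2 * R ≤ φ ^ 2 / a ^ 2 * G + (b ^ 2 - φ ^ 2) * h)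
    (hP' : β * b' ^ 2 * R ≤ φ' ^ 2 / a' ^ 2 * G' + (b' ^ 2 - φ' ^ 2) * h) :
    |√(φ' ^ 2 / a' ^ 2 * G' + (b' ^ 2 - φ' ^ 2) * h) -
      √(φ ^ 2 / a ^ 2 * G + (b ^ 2 - φ ^ 2) * h)| ≤
      |φ' / a' * √G' - φ / a * √G| + K * √R / √β * (|b' - b| + |φ' - φ|) := by
  have key : ∀ {a φ G b : ℝ}, 0 ≤ a → 0 ≤ φ → √(φ ^ 2 / a ^ 2 * G) = φ / a * √G := by
    intro a φ G b ha hφ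
    rw [Real.sqrt_mul (by positivity), ← div_pow, Real.sqrt_sq (by positivity)]
  have lb : ∀ {b P : ℝ}, β * b ^ 2 * R ≤ P → √β * √R * b ≤ √P := by
    intro b P hP
    refine Real.le_sqrt_of_sq_le ?_
    rw [mul_pow, mul_pow, Real.sq_sqrt hβ.le, Real.sq_sqrt hR]
    refine le_trans (le_of_eq (by ring)) hP
  have hB := abs_sq_sub_sq_mul_sub_le hb hb' hφ hφ' hφb hφb' hh hR hK hβ hhR (lb hP) (lb hP')
  rw [← key (b := b) ha hφ, ← key (b := b) ha' hφ']
  refine abs_sqrt_add_sub_sqrt_add_le (by positivity) (by positivity) (mul_nonneg ?_ hh)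
    (mul_nonneg ?_ hh) (by positivity) hB
  · exact sub_nonneg.2 (pow_le_pow_left₀ hφ hφb 2)
  · exact sub_nonneg.2 (pow_le_pow_left₀ hφ' hφb' 2)

/-- All increments of `√μ`, `√ν` and their minimum are gathered into one factor depending on `t`
only, multiplied by quantities whose integral over the other coordinates is controlled. -/
lemma sq_sqrt_proj_sub_le {a a' b b' G G' h R K β : ℝ} (ha : 0 ≤ a) (ha' : 0 ≤ a') (hb : 0 ≤ b)
    (hb' : 0 ≤ b') (hG : 0 ≤ G) (hG' : 0 ≤ G') (hh : 0 ≤ h) (hR : 0 ≤ R) (hK : 0 ≤ K)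
    (hβ : 0 < β) (hhR : h ≤ K * R) (h0 : a' = 0 → G' = 0)
    (hP : β * b ^ 2 * R ≤ min a b ^ 2 / a ^ 2 * G + (b ^ 2 - min a b ^ 2) * h)
    (hP' : β * b' ^ 2 * R ≤ min a' b' ^ 2 / a' ^ 2 * G' + (b' ^ 2 - min a' b' ^ 2) * h) :
    (√(min a' b' ^ 2 / a' ^ 2 * G' + (b' ^ 2 - min a' b' ^ 2) * h) -
      √(min a b ^ 2 / a ^ 2 * G + (b ^ 2 - min a b ^ 2) * h)) ^ 2 ≤
      3 * ((√G' - √G) ^ 2 + ((a' - a) ^ 2 + (b' - b) ^ 2) *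
        (4 * (G' / a' ^ 2) + 4 * K ^ 2 / β * R)) := by
  have h1 := abs_sqrt_proj_sub_le hb hb' ha ha' (le_min ha hb) (le_min ha' hb')
    (min_le_right _ _) (min_le_right _ _) hG hG' hh hR hK hβ hhR hP hP'
  have h2 := abs_min_div_mul_sub_le (b' := b') (g := √G) ha ha' hb (Real.sqrt_nonneg G')
    (fun h => by rw [h0 h, Real.sqrt_zero])
  have h3 := h1.trans (add_le_add_left h2 _)
  rw [← sq_abs, ← sq_abs (√G' - √G)]
  refine (pow_le_pow_left₀ (abs_nonneg _) h3 2).trans ?_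
  refine sq_add_add_le hR (by positivity) hβ ?_ ?_ (abs_min_sub_min_sq_le a a' b b') ?_ rfl
  · rw [sq_abs]
    exact le_add_of_nonneg_right (sq_nonneg _)
  · rw [sq_abs]
    exact le_add_of_nonneg_left (sq_nonneg _)
  · rw [div_pow, Real.sq_sqrt hG']

end Pointwise

/-! ### Contraction of Hellinger increments under integration -/

section Hellinger

lemma eLpNorm_two_sq {X : Type*} [MeasurableSpace X] (ρ : Measure X) (f : X → ℝ) :
    eLpNorm f 2 ρ ^ 2 = ∫⁻ x, ENNReal.ofReal (f x ^ 2) ∂ρ := by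
  rw [eLpNorm_eq_lintegral_rpow_enorm_toReal (by norm_num) (by norm_num)]
  simp only [ENNReal.toReal_ofNat, ENNReal.rpow_ofNat]
  rw [← ENNReal.rpow_natCast, ← ENNReal.rpow_mul]
  norm_num
  refine lintegral_congr fun x => ?_
  rw [Real.enorm_eq_ofReal_abs, ← ENNReal.ofReal_pow (abs_nonneg _), sq_abs]

lemma eLpNorm_two_le_iff {X : Type*} [MeasurableSpace X] (ρ : Measure X) (f : X → ℝ) {C : ℝ}
    (hC : 0 ≤ C) : eLpNorm f 2 ρ ≤ ENNReal.ofReal C ↔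
      ∫⁻ x, ENNReal.ofReal (f x ^ 2) ∂ρ ≤ ENNReal.ofReal (C ^ 2) := by
  rw [← eLpNorm_two_sq, ENNReal.ofReal_pow hC]
  exact (ENNReal.pow_le_pow_left_iff (by norm_num)).symm

/-- The roots of the integrals are the L² norms of `√F` and `√G`, so this is the reverse triangle
inequality. -/
lemma ofReal_sqrt_lintegral_sub_sq_le {Y : Type*} [MeasurableSpace Y] (ρ : Measure Y)
    {F G : Y → ℝ} (hFm : AEMeasurable F ρ) (hGm : AEMeasurable G ρ) (hF0 : ∀ y, 0 ≤ F y)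
    (hG0 : ∀ y, 0 ≤ G y) (hF : ∫⁻ y, ENNReal.ofReal (F y) ∂ρ ≠ ⊤)
    (hG : ∫⁻ y, ENNReal.ofReal (G y) ∂ρ ≠ ⊤) :
    ENNReal.ofReal ((√(∫⁻ y, ENNReal.ofReal (F y) ∂ρ).toReal -
      √(∫⁻ y, ENNReal.ofReal (G y) ∂ρ).toReal) ^ 2) ≤
      ∫⁻ y, ENNReal.ofReal ((√(F y) - √(G y)) ^ 2) ∂ρ := by
  have key : ∀ H : Y → ℝ, (∀ y, 0 ≤ H y) →
      √(∫⁻ y, ENNReal.ofReal (H y) ∂ρ).toReal = (eLpNorm (fun y => √(H y)) 2 ρ).toReal := by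
    intro H hH
    rw [Real.sqrt_eq_iff_mul_self_eq (by positivity) (by positivity), ← pow_two,
      ← ENNReal.toReal_pow, eLpNorm_two_sq]
    simp_rw [Real.sq_sqrt (hH _)]
  have mem : ∀ H : Y → ℝ, AEMeasurable H ρ → (∀ y, 0 ≤ H y) →
      ∫⁻ y, ENNReal.ofReal (H y) ∂ρ ≠ ⊤ → MemLp (fun y => √(H y)) 2 ρ := by
    intro H hm hH hfin
    refine ⟨hm.sqrt.aestronglyMeasurable, ?_⟩
    have := eLpNorm_two_sq ρ (fun y => √(H y))
    simp_rw [Real.sq_sqrt (hH _)] at this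
    rw [← this] at hfin
    exact lt_top_iff_ne_top.2 fun h => hfin (by simp [h])
  have hu := mem F hFm hF0 hF
  have hv := mem G hGm hG0 hG
  rw [key F hF0, key G hG0, ← eLpNorm_two_sq ρ (fun y => √(F y) - √(G y)),
    ← ENNReal.ofReal_toReal (a := eLpNorm (fun y => √(F y) - √(G y)) 2 ρ)
      (hu.sub hv).eLpNorm_ne_top,
    ← ENNReal.ofReal_pow ENNReal.toReal_nonneg]
  refine ENNReal.ofReal_le_ofReal ?_
  rw [← sq_abs]
  refine pow_le_pow_left₀ (abs_nonneg _) ?_ 2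
  have := abs_norm_sub_norm_le hu.toLp hv.toLp
  rw [← MemLp.toLp_sub, Lp.norm_toLp, Lp.norm_toLp, Lp.norm_toLp] at this
  exact this

end Hellinger

/-! ### The integrated increment estimate in one coordinate -/

section Core

variable {d : ℕ} {μ ν : Pt d → ℝ}

lemma sqrt_common (μ ν : Pt d → ℝ) (t : Pt d) : √(common μ ν t) = min √(μ t) √(ν t) :=
  (Real.sqrt_monotone.map_min)

lemma common_eq_sq (hμ0 : ∀ x, 0 ≤ μ x) (hν0 : ∀ x, 0 ≤ ν x) (t : Pt d) :
    common μ ν t = min √(μ t) √(ν t) ^ 2 := by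
  rw [← sqrt_common, Real.sq_sqrt (common_nonneg hμ0 hν0 t)]

/-- The pointwise bound is integrated over `Y` first: `∫ G(t + w, ·) / μ(t + w) ≤ 1` and `∫ R ≤ 1`
turn the bracket into the constant `4 + 4 K² / β`, leaving only the increments of `√μ` and `√ν` in
`t`. -/
lemma lintegral_sqrt_proj_sub_le {Y : Type*} [MeasurableSpace Y] (ρ : Measure Y) [SFinite ρ]
    (hμm : Measurable μ) (hνm : Measurable ν) (hμ0 : ∀ x, 0 ≤ μ x) (hν0 : ∀ x, 0 ≤ ν x)
    {G : Pt d × Y → ℝ} (hGm : Measurable G) (hG0 : ∀ z, 0 ≤ G z) {R h : Y → ℝ}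
    (hRm : Measurable R) (hR0 : ∀ y, 0 ≤ R y) (hh0 : ∀ y, 0 ≤ h y)
    {β K : ℝ} (hβ : 0 < β) (hK : 0 ≤ K)
    (hmarg : ∀ᵐ t, ∫⁻ y, ENNReal.ofReal (G (t, y)) ∂ρ ≤ ENNReal.ofReal (μ t))
    (hhR : ∀ᵐ y ∂ρ, h y ≤ K * R y)
    (hpos : ∀ᵐ z ∂((volume : Measure (Pt d)).prod ρ), β * ν z.1 * R z.2 ≤
      common μ ν z.1 * (μ z.1)⁻¹ * G z + excess ν μ z.1 * h z.2)
    (hR : ∫⁻ y, ENNReal.ofReal (R y) ∂ρ ≤ 1) (w : Pt d) :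
    ∫⁻ z, ENNReal.ofReal
      ((√(common μ ν (z.1 + w) * (μ (z.1 + w))⁻¹ * G (z.1 + w, z.2) +
          excess ν μ (z.1 + w) * h z.2) -
        √(common μ ν z.1 * (μ z.1)⁻¹ * G z + excess ν μ z.1 * h z.2)) ^ 2)
      ∂((volume : Measure (Pt d)).prod ρ) ≤
    3 * ((∫⁻ z, ENNReal.ofReal ((√(G (z.1 + w, z.2)) - √(G z)) ^ 2)
        ∂((volume : Measure (Pt d)).prod ρ)) +
      (∫⁻ t, ENNReal.ofReal ((√(μ (t + w)) - √(μ t)) ^ 2 + (√(ν (t + w)) - √(ν t)) ^ 2)) *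
        ENNReal.ofReal (4 + 4 * K ^ 2 / β)) := by
  set m : Measure (Pt d × Y) := (volume : Measure (Pt d)).prod ρ with hm
  set D : Pt d → ℝ := fun t => (√(μ (t + w)) - √(μ t)) ^ 2 + (√(ν (t + w)) - √(ν t)) ^ 2 with hD
  have hD0 : ∀ t, 0 ≤ D t := fun t => by positivity
  have hDm : Measurable D := by fun_prop
  clear_value D
  have hI : ∫⁻ t, ENNReal.ofReal ((√(μ (t + w)) - √(μ t)) ^ 2 + (√(ν (t + w)) - √(ν t)) ^ 2) =
      ∫⁻ t, ENNReal.ofReal (D t) := by rw [hD]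
  rw [hI]
  have htr : MeasurePreserving (fun t : Pt d => t + w) := measurePreserving_add_right volume w
  have htr2 : MeasurePreserving (Prod.map (fun t : Pt d => t + w) (id : Y → Y)) m m :=
    htr.prod (MeasurePreserving.id ρ)
  have hGm' : Measurable fun z : Pt d × Y => G (z.1 + w, z.2) :=
    hGm.comp ((measurable_fst.add_const w).prodMk measurable_snd)
  -- A slice over a point with `μ = 0` has zero integral, so `G` vanishes almost everywhere on it
  -- and the quotient `G / μ` loses nothing.
  have hzero : ∀ᵐ z ∂m, μ z.1 = 0 → G z = 0 := by
    have hmeas : MeasurableSet {z : Pt d × Y | μ z.1 = 0 → G z = 0} := by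
      refine MeasurableSet.imp ?_ ?_
      · exact (hμm.comp measurable_fst) (measurableSet_singleton 0)
      · exact hGm (measurableSet_singleton 0)
    refine (Measure.ae_prod_iff_ae_ae hmeas).2 ?_
    filter_upwards [hmarg] with t ht
    by_cases h0 : μ t = 0
    · have hGt : Measurable fun y => G (t, y) := hGm.comp measurable_prodMk_left
      rw [h0, ENNReal.ofReal_zero, nonpos_iff_eq_zero,
        lintegral_eq_zero_iff hGt.ennreal_ofReal] at ht
      filter_upwards [ht] with y hy _
      exact le_antisymm (ENNReal.ofReal_eq_zero.1 hy) (hG0 _)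
    · exact Filter.Eventually.of_forall fun y hy => absurd hy h0
  have hhR' : ∀ᵐ z ∂m, h z.2 ≤ K * R z.2 := Measure.quasiMeasurePreserving_snd.ae hhR
  have hpt : ∀ᵐ z ∂m, ENNReal.ofReal
      ((√(common μ ν (z.1 + w) * (μ (z.1 + w))⁻¹ * G (z.1 + w, z.2) +
          excess ν μ (z.1 + w) * h z.2) -
        √(common μ ν z.1 * (μ z.1)⁻¹ * G z + excess ν μ z.1 * h z.2)) ^ 2) ≤
      3 * (ENNReal.ofReal ((√(G (z.1 + w, z.2)) - √(G z)) ^ 2) +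
        ENNReal.ofReal (D z.1) * (4 * (ENNReal.ofReal (μ (z.1 + w))⁻¹ *
          ENNReal.ofReal (G (z.1 + w, z.2))) + ENNReal.ofReal (4 * K ^ 2 / β) *
          ENNReal.ofReal (R z.2))) := by
    filter_upwards [hhR', hpos, htr2.quasiMeasurePreserving.ae hpos,
      htr2.quasiMeasurePreserving.ae hzero] with z z1 z2 z3 z4
    simp only [id, Prod.map_apply'] at z3 z4
    have c : ∀ t g, common μ ν t * (μ t)⁻¹ * g + excess ν μ t * h z.2 =
        min √(μ t) √(ν t) ^ 2 / √(μ t) ^ 2 * g +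
          (√(ν t) ^ 2 - min √(μ t) √(ν t) ^ 2) * h z.2 := by
      intro t g
      rw [excess_eq, common_comm ν μ, common_eq_sq hμ0 hν0, Real.sq_sqrt (hμ0 t),
        Real.sq_sqrt (hν0 t), div_eq_mul_inv]
    rw [c] at z2 z3
    rw [c, c]
    have key := sq_sqrt_proj_sub_le (Real.sqrt_nonneg (μ z.1)) (Real.sqrt_nonneg (μ (z.1 + w)))
      (Real.sqrt_nonneg (ν z.1)) (Real.sqrt_nonneg (ν (z.1 + w))) (hG0 z) (hG0 (z.1 + w, z.2))
      (hh0 z.2) (hR0 z.2) hK hβ z1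
      (fun h0 => z4 ((Real.sqrt_eq_zero (hμ0 _)).1 h0))
      (by simpa only [Real.sq_sqrt (hν0 _)] using z2)
      (by simpa only [Real.sq_sqrt (hν0 _)] using z3)
    rw [← show D z.1 = _ from congrFun hD z.1] at key
    refine (ENNReal.ofReal_le_ofReal key).trans (le_of_eq ?_)
    have i1 : 0 ≤ (μ (z.1 + w))⁻¹ := inv_nonneg.2 (hμ0 _)
    have i2 := hG0 (z.1 + w, z.2)
    have i3 := hR0 z.2
    have i4 := hD0 z.1
    rw [ENNReal.ofReal_mul (by norm_num), ENNReal.ofReal_add (by positivity)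
      (mul_nonneg i4 (by positivity)), ENNReal.ofReal_mul i4,
      ENNReal.ofReal_add (by positivity) (by positivity), ENNReal.ofReal_mul (by norm_num),
      ENNReal.ofReal_mul (p := 4 * K ^ 2 / β) (by positivity), Real.sq_sqrt (hμ0 _),
      div_eq_inv_mul (G _), ENNReal.ofReal_mul i1]
    norm_num
  refine (lintegral_mono_ae hpt).trans ?_
  have hGμ : Measurable fun z : Pt d × Y => ENNReal.ofReal (μ (z.1 + w))⁻¹ *
      ENNReal.ofReal (G (z.1 + w, z.2)) := by
    exact ((hμm.comp (measurable_fst.add_const w)).inv.ennreal_ofReal).mul hGm'.ennreal_ofReal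
  have hinner : Measurable fun z : Pt d × Y => ENNReal.ofReal (D z.1) *
      (4 * (ENNReal.ofReal (μ (z.1 + w))⁻¹ * ENNReal.ofReal (G (z.1 + w, z.2))) +
        ENNReal.ofReal (4 * K ^ 2 / β) * ENNReal.ofReal (R z.2)) :=
    (hDm.comp measurable_fst).ennreal_ofReal.mul ((hGμ.const_mul 4).add
      ((hRm.comp measurable_snd).ennreal_ofReal.const_mul _))
  rw [lintegral_const_mul' _ _ (by norm_num), lintegral_add_right _ hinner]
  gcongr
  rw [hm, lintegral_prod _ hinner.aemeasurable]
  dsimp only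
  rw [← lintegral_mul_const _ hDm.ennreal_ofReal]
  refine lintegral_mono_ae ?_
  filter_upwards [htr.quasiMeasurePreserving.ae hmarg] with t ht
  rw [lintegral_const_mul' _ _ ENNReal.ofReal_ne_top]
  gcongr
  rw [lintegral_add_right _ (hRm.ennreal_ofReal.const_mul _), lintegral_const_mul' _ _ (by norm_num),
    lintegral_const_mul' _ _ ENNReal.ofReal_ne_top, lintegral_const_mul' _ _ ENNReal.ofReal_ne_top,
    ENNReal.ofReal_add (by norm_num) (by positivity)]
  refine add_le_add ?_ ?_
  · calc _ ≤ 4 * (ENNReal.ofReal (μ (t + w))⁻¹ * ENNReal.ofReal (μ (t + w))) := by gcongr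
      _ ≤ 4 * 1 := by
        gcongr
        rw [ofReal_inv_mul_ofReal (hμ0 _)]
        split_ifs <;> simp
      _ = _ := by simp
  · exact (mul_le_mul_right hR _).trans (mul_one _).le

end Core

end SobPres

namespace SobPres

open ProbabilityTheory
open scoped ENNReal

/-! ### The projected plan: slicing, total mass and marginals -/

section Projection

variable {n d : ℕ} {μ ν : Pt d → ℝ} {γ : Conf (n + 1) d → ℝ}

/-- Two everywhere nonnegative Borel probability densities. -/
structure BorelDensities (μ ν : Pt d → ℝ) : Prop where
  meas_left : Measurable μ
  meas_right : Measurable ν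
  nonneg_left : ∀ x, 0 ≤ μ x
  nonneg_right : ∀ x, 0 ≤ ν x
  density_left : IsProbDensity μ
  density_right : IsProbDensity ν

lemma BorelDensities.integral_eq (h : BorelDensities μ ν) : ∫ x, μ x = ∫ x, ν x :=
  h.density_left.integral_eq_one.trans h.density_right.integral_eq_one.symm

/-- The projected plan as an extended nonnegative function. -/
noncomputable def projE {N : ℕ} (μ ν : Pt d → ℝ) (γ : Conf N d → ℝ) (x : Conf N d) : ℝ≥0∞ :=
  ∫⁻ x', weight μ x' * ENNReal.ofReal (γ x') ∂(planPi μ ν x)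

/-- The plan projected in all coordinates except the `i`-th one. -/
noncomputable def projRest (μ ν : Pt d → ℝ) (γ : Conf (n + 1) d → ℝ) (i : Fin (n + 1))
    (z : Pt d × Conf n d) : ℝ≥0∞ :=
  ∫⁻ y', weight μ y' * ENNReal.ofReal (γ (i.insertNth z.1 y')) ∂(planPi μ ν z.2)

lemma measurable_insertNth (i : Fin (n + 1)) :
    Measurable fun z : Pt d × Conf n d => (i.insertNth z.1 z.2 : Conf (n + 1) d) :=
  (MeasurableEquiv.piFinSuccAbove (fun _ => Pt d) i).symm.measurable

lemma measurePreserving_insertNth (i : Fin (n + 1)) :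
    MeasurePreserving (fun z : Pt d × Conf n d => (i.insertNth z.1 z.2 : Conf (n + 1) d)) :=
  (volume_preserving_piFinSuccAbove (fun _ => Pt d) i).symm

lemma lintegral_insertNth (i : Fin (n + 1)) (F : Conf (n + 1) d → ℝ≥0∞) :
    ∫⁻ x, F x = ∫⁻ z : Pt d × Conf n d, F (i.insertNth z.1 z.2) :=
  ((measurePreserving_insertNth i).lintegral_comp_emb
    (MeasurableEquiv.piFinSuccAbove (fun _ => Pt d) i).symm.measurableEmbedding F).symm

lemma proj_eq_toReal {N : ℕ} {γ : Conf N d → ℝ} (hγm : Measurable γ) (hγ0 : ∀ x, 0 ≤ γ x)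
    (hμm : Measurable μ) (hμ0 : ∀ x, 0 ≤ μ x) (x : Conf N d) :
    proj μ ν γ x = (projE μ ν γ x).toReal := by
  have hw : ∀ x : Conf N d, 0 ≤ ∏ i, (μ (x i))⁻¹ := fun x =>
    Finset.prod_nonneg fun i _ => inv_nonneg.2 (hμ0 _)
  have hm : Measurable fun x : Conf N d => (∏ i, (μ (x i))⁻¹) * γ x :=
    (Finset.measurable_fun_prod _ fun i _ => (hμm.comp (measurable_pi_apply i)).inv).mul hγm
  rw [proj, integral_eq_lintegral_of_nonneg_ae
    (Filter.Eventually.of_forall fun x => mul_nonneg (hw x) (hγ0 x)) hm.aestronglyMeasurable]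
  simp_rw [ENNReal.ofReal_mul (hw _)]
  rfl

variable (h : BorelDensities μ ν) (hγm : Measurable γ)
include h hγm

lemma measurable_projE : Measurable (projE μ ν γ) := by
  let κ : Kernel (Conf (n + 1) d) (Conf (n + 1) d) :=
    ⟨planPi μ ν, measurable_planPi h.meas_left h.meas_right h.density_left.integrable
      h.density_right.integrable⟩
  exact ((measurable_weight h.meas_left).mul hγm.ennreal_ofReal).lintegral_kernel (κ := κ)

lemma measurable_projRest (i : Fin (n + 1)) : Measurable (projRest μ ν γ i) := by
  let κ : Kernel (Conf n d) (Conf n d) :=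
    ⟨planPi μ ν, measurable_planPi h.meas_left h.meas_right h.density_left.integrable
      h.density_right.integrable⟩
  have hfin : ∀ y, IsFiniteMeasure (κ y) :=
    isFiniteMeasure_planPi h.density_left.integrable h.density_right.integrable
  have := isSFiniteKernel_of_isFiniteMeasure κ
  have hm : Measurable fun p : (Pt d × Conf n d) × Conf n d =>
      weight μ p.2 * ENNReal.ofReal (γ (i.insertNth p.1.1 p.2)) := by
    refine ((measurable_weight h.meas_left).comp measurable_snd).mul ?_
    exact (hγm.comp ((measurable_insertNth i).comp
      ((measurable_fst.comp measurable_fst).prodMk measurable_snd))).ennreal_ofReal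
  exact hm.lintegral_kernel_prod_right' (κ := κ.comap Prod.snd measurable_snd)

lemma projE_insertNth (i : Fin (n + 1)) (t : Pt d) (y : Conf n d) :
    projE μ ν γ (i.insertNth t y) =
      ∫⁻ t', ENNReal.ofReal (μ t')⁻¹ * projRest μ ν γ i (t', y) ∂(planBA μ ν t) := by
  have := isFiniteMeasure_planBA h.density_left.integrable h.density_right.integrable
  have hmp := (measurePreserving_piFinSuccAbove
    (fun j => planBA μ ν ((i.insertNth t y : Conf (n + 1) d) j)) i).symm
  have hm : Measurable fun x : Conf (n + 1) d => weight μ x * ENNReal.ofReal (γ x) :=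
    (measurable_weight h.meas_left).mul hγm.ennreal_ofReal
  rw [projE, planPi, ← hmp.lintegral_comp hm]
  simp only [Fin.insertNth_apply_same, Fin.insertNth_apply_succAbove]
  have hm2 : Measurable fun z : Pt d × Conf n d =>
      weight μ (i.insertNth z.1 z.2 : Conf (n + 1) d) *
        ENNReal.ofReal (γ (i.insertNth z.1 z.2)) := hm.comp (measurable_insertNth i)
  refine (lintegral_prod _ hm2.aemeasurable).trans ?_
  refine lintegral_congr fun t' => ?_
  have hm3 : Measurable fun y' : Conf n d =>
      weight μ y' * ENNReal.ofReal (γ (i.insertNth t' y')) :=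
    (measurable_weight h.meas_left).mul
      (hγm.comp ((measurable_insertNth i).comp measurable_prodMk_left)).ennreal_ofReal
  rw [projRest, ← lintegral_const_mul _ hm3, planPi]
  refine lintegral_congr fun y' => ?_
  rw [← mul_assoc]
  congr 1
  rw [weight, Fin.prod_univ_succAbove _ i, ENNReal.ofReal_mul (inv_nonneg.2 (h.nonneg_left _))]
  simp only [Fin.insertNth_apply_same, Fin.insertNth_apply_succAbove]
  rfl

lemma projE_insertNth_eq (i : Fin (n + 1)) (t : Pt d) (y : Conf n d) :
    projE μ ν γ (i.insertNth t y) =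
      ENNReal.ofReal (common μ ν t) * (ENNReal.ofReal (μ t)⁻¹ * projRest μ ν γ i (t, y)) +
      ENNReal.ofReal (excess ν μ t / ∫ z, excess ν μ z) *
        ∫⁻ t', ENNReal.ofReal (excess μ ν t') *
          (ENNReal.ofReal (μ t')⁻¹ * projRest μ ν γ i (t', y)) := by
  rw [projE_insertNth h hγm, lintegral_planBA h.meas_left h.meas_right]
  exact h.meas_left.inv.ennreal_ofReal.mul
    ((measurable_projRest h hγm i).comp measurable_prodMk_right)

variable (hγ0 : ∀ x, 0 ≤ γ x) (hγ : Integrable γ)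
  (hmarg : ∀ i, oneMarginal γ i =ᵐ[volume] μ)
include hγ0 hγ hmarg

omit h hγm in
lemma ae_lintegral_insertNth (i : Fin (n + 1)) :
    ∀ᵐ t, ∫⁻ y, ENNReal.ofReal (γ (i.insertNth t y)) = ENNReal.ofReal (μ t) := by
  have h1 : Integrable fun z : Pt d × Conf n d => γ (i.insertNth z.1 z.2) :=
    (measurePreserving_insertNth i).integrable_comp_of_integrable hγ
  filter_upwards [hmarg i, h1.prod_right_ae] with t ht hint
  rw [← ht, oneMarginal, ofReal_integral_eq_lintegral_ofReal hint
    (Filter.Eventually.of_forall fun y => hγ0 _)]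

omit hγm hmarg h in
lemma ae_lintegral_insertNth_rest (i : Fin (n + 1)) :
    ∀ᵐ y, ∫⁻ t, ENNReal.ofReal (γ (i.insertNth t y)) = ENNReal.ofReal (restMarginal γ i y) := by
  have h1 : Integrable fun z : Pt d × Conf n d => γ (i.insertNth z.1 z.2) :=
    (measurePreserving_insertNth i).integrable_comp_of_integrable hγ
  filter_upwards [h1.prod_left_ae] with y hint
  rw [restMarginal, ofReal_integral_eq_lintegral_ofReal hint
    (Filter.Eventually.of_forall fun y => hγ0 _)]

lemma ae_eq_zero_of_marginal_eq_zero : ∀ᵐ x, ∀ j, μ (x j) = 0 → γ x = 0 := by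
  refine ae_all_iff.2 fun j => ?_
  have hs : MeasurableSet {x : Conf (n + 1) d | μ (x j) = 0 → γ x = 0} :=
    MeasurableSet.imp ((h.meas_left.comp (measurable_pi_apply j)) (measurableSet_singleton 0))
      (hγm (measurableSet_singleton 0))
  rw [← (measurePreserving_insertNth j).map_eq]
  refine (ae_map_iff (measurable_insertNth j).aemeasurable hs).2 ?_
  refine (Measure.ae_prod_iff_ae_ae ((measurable_insertNth j) hs)).2 ?_
  filter_upwards [ae_lintegral_insertNth hγ0 hγ hmarg j] with t ht
  by_cases h0 : μ t = 0
  · have hm : Measurable fun y => γ (j.insertNth t y) :=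
      hγm.comp ((measurable_insertNth j).comp measurable_prodMk_left)
    rw [h0, ENNReal.ofReal_zero, lintegral_eq_zero_iff hm.ennreal_ofReal] at ht
    filter_upwards [ht] with y hy _
    exact le_antisymm (ENNReal.ofReal_eq_zero.1 hy) (hγ0 _)
  · refine Filter.Eventually.of_forall fun y hy => absurd ?_ h0
    simpa using hy

/-- Projecting the other coordinates preserves the integral of each slice: the weights cancel off
`{μ = 0}`, and `γ` vanishes there. -/
lemma ae_lintegral_projRest (i : Fin (n + 1)) :
    ∀ᵐ t, ∫⁻ y, projRest μ ν γ i (t, y) = ENNReal.ofReal (μ t) := by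
  have h0 := (measurePreserving_insertNth i).quasiMeasurePreserving.ae
    (ae_eq_zero_of_marginal_eq_zero h hγm hγ0 hγ hmarg)
  filter_upwards [ae_lintegral_insertNth hγ0 hγ hmarg i, Measure.ae_ae_of_ae_prod h0]
    with t ht h0t
  have hm : Measurable fun y => γ (i.insertNth t y) :=
    hγm.comp ((measurable_insertNth i).comp measurable_prodMk_left)
  rw [← ht]
  refine lintegral_lintegral_planPi_eq h.meas_left h.meas_right h.nonneg_left h.nonneg_right
    h.density_left.integrable h.density_right.integrable h.integral_eq hm.ennreal_ofReal ?_
  filter_upwards [h0t] with y hy j hj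
  rw [hy (i.succAbove j) (by simpa using hj), ENNReal.ofReal_zero]

lemma ae_lintegral_projE (i : Fin (n + 1)) :
    ∀ᵐ t, ∫⁻ y, projE μ ν γ (i.insertNth t y) = ENNReal.ofReal (ν t) := by
  have hfin := isFiniteMeasure_planBA h.density_left.integrable h.density_right.integrable
  -- The slice identity is known only for Lebesgue almost every `t'`; as `planBA μ ν t` has an atom
  -- at `t`, it is transferred through the second marginal.
  have hae : ∀ᵐ t, ∀ᵐ t' ∂(planBA μ ν t),
      ∫⁻ y, projRest μ ν γ i (t', y) = ENNReal.ofReal (μ t') := by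
    refine Measure.ae_ae_of_ae_bind (measurable_planBA h.meas_left h.meas_right).aemeasurable ?_
    rw [bind_planBA h.meas_left h.meas_right h.nonneg_left h.nonneg_right
      h.density_left.integrable h.density_right.integrable h.integral_eq]
    exact (withDensity_absolutelyContinuous _ _).ae_le
      (ae_lintegral_projRest h hγm hγ0 hγ hmarg i)
  filter_upwards [hae, planBA_univ h.meas_left h.meas_right h.nonneg_left h.nonneg_right
      h.density_left.integrable h.density_right.integrable h.integral_eq] with t ht hu
  simp_rw [projE_insertNth h hγm]
  have hm := measurable_projRest h hγm i
  -- Integrating over `y` first turns the integrand into `μ(t')⁻¹ μ(t') = 1`, so what remains is the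
  -- mass of the plan at `t`, namely `ν t`.
  rw [lintegral_lintegral_swap (by
    exact ((h.meas_left.comp measurable_snd).inv.ennreal_ofReal.mul
      (hm.comp measurable_swap)).aemeasurable), ← hu, ← lintegral_one]
  refine lintegral_congr_ae ?_
  filter_upwards [ht, ae_planBA_ne_zero h.meas_left h.meas_right h.nonneg_left h.nonneg_right t]
    with t' h1 h2
  rw [lintegral_const_mul' _ _ ENNReal.ofReal_ne_top, h1, ofReal_inv_mul_ofReal (h.nonneg_left _),
    if_neg h2]

lemma lintegral_projE : ∫⁻ x, projE μ ν γ x = 1 := by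
  have hm : Measurable fun z : Pt d × Conf n d =>
      projE μ ν γ ((0 : Fin (n + 1)).insertNth z.1 z.2) :=
    (measurable_projE h hγm).comp (measurable_insertNth 0)
  rw [lintegral_insertNth 0, Measure.volume_eq_prod, lintegral_prod _ hm.aemeasurable,
    lintegral_congr_ae (ae_lintegral_projE h hγm hγ0 hγ hmarg 0),
    ← ofReal_integral_eq_lintegral_ofReal h.density_right.integrable h.density_right.nonneg,
    h.density_right.integral_eq_one, ENNReal.ofReal_one]

lemma isProbDensity_proj : IsProbDensity (proj μ ν γ) := by
  have e : proj μ ν γ = fun x => (projE μ ν γ x).toReal :=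
    funext fun x => proj_eq_toReal hγm hγ0 h.meas_left h.nonneg_left x
  have hm := measurable_projE h hγm
  have h1 := lintegral_projE h hγm hγ0 hγ hmarg
  have hlt : ∀ᵐ x, projE μ ν γ x < ⊤ := ae_lt_top hm (by simp [h1])
  rw [e]
  refine ⟨integrable_toReal_of_lintegral_ne_top hm.aemeasurable (by simp [h1]),
    Filter.Eventually.of_forall fun x => ENNReal.toReal_nonneg, ?_⟩
  rw [integral_toReal hm.aemeasurable hlt, h1, ENNReal.toReal_one]

lemma oneMarginal_proj (i : Fin (n + 1)) : oneMarginal (proj μ ν γ) i =ᵐ[volume] ν := by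
  filter_upwards [ae_lintegral_projE h hγm hγ0 hγ hmarg i] with t ht
  have hm : Measurable fun y => projE μ ν γ (i.insertNth t y) :=
    (measurable_projE h hγm).comp ((measurable_insertNth i).comp measurable_prodMk_left)
  simp_rw [oneMarginal, proj_eq_toReal hγm hγ0 h.meas_left h.nonneg_left]
  rw [integral_toReal hm.aemeasurable (ae_lt_top hm (by simp [ht])), ht,
    ENNReal.toReal_ofReal (h.nonneg_right t)]

end Projection

end SobPres

namespace SobPres

open ProbabilityTheory
open scoped ENNReal

/-! ### Sobolev regularity of the projected plan -/

lemma translationLipschitz_iff {X : Type*} [NormedAddCommGroup X] [NormedSpace ℝ X]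
    [MeasureSpace X] {u : X → ℝ} {v : X} : TranslationLipschitz u v ↔
      ∃ C : ℝ, 0 ≤ C ∧ ∀ s : ℝ,
        ∫⁻ x, ENNReal.ofReal ((u (x + s • v) - u x) ^ 2) ≤ ENNReal.ofReal (C * s ^ 2) := by
  constructor
  · rintro ⟨C, hC, h⟩
    refine ⟨C ^ 2, by positivity, fun s => ?_⟩
    have := (eLpNorm_two_le_iff volume _ (by positivity)).1 (h s)
    rwa [mul_pow, sq_abs] at this
  · rintro ⟨C, hC, h⟩
    refine ⟨√C, by positivity, fun s => ?_⟩
    refine (eLpNorm_two_le_iff volume _ (by positivity)).2 ?_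
    rw [mul_pow, sq_abs, Real.sq_sqrt hC]
    exact h s

section Regularity

variable {n d : ℕ} {μ ν : Pt d → ℝ} {γ : Conf (n + 1) d → ℝ}

lemma insertNth_add_single (i : Fin (n + 1)) (t w : Pt d) (y : Conf n d) :
    (i.insertNth t y : Conf (n + 1) d) + Pi.single i w = i.insertNth (t + w) y := by
  ext j : 1
  rcases Fin.eq_self_or_eq_succAbove i j with rfl | ⟨k, rfl⟩
  · simp
  · simp [Fin.succAbove_ne]

lemma lintegral_sub_single (u : Conf (n + 1) d → ℝ) (i : Fin (n + 1)) (w : Pt d) :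
    ∫⁻ x, ENNReal.ofReal ((u (x + Pi.single i w) - u x) ^ 2) =
      ∫⁻ z : Pt d × Conf n d,
        ENNReal.ofReal ((u (i.insertNth (z.1 + w) z.2) - u (i.insertNth z.1 z.2)) ^ 2) := by
  rw [lintegral_insertNth i]
  simp_rw [insertNth_add_single]

/-- The mass `∫ P dxᵢ` of the plan projected in all coordinates except the `i`-th one. -/
noncomputable def projRestMass (μ ν : Pt d → ℝ) (γ : Conf (n + 1) d → ℝ) (i : Fin (n + 1))
    (y : Conf n d) : ℝ≥0∞ := ∫⁻ t, projRest μ ν γ i (t, y)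

/-- The density that the second part of the plan spreads over the excess of `ν`. -/
noncomputable def projRestExcess (μ ν : Pt d → ℝ) (γ : Conf (n + 1) d → ℝ) (i : Fin (n + 1))
    (y : Conf n d) : ℝ≥0∞ :=
  ∫⁻ t, ENNReal.ofReal (excess μ ν t) * (ENNReal.ofReal (μ t)⁻¹ * projRest μ ν γ i (t, y))

lemma excess_le (hμ0 : ∀ x, 0 ≤ μ x) (hν0 : ∀ x, 0 ≤ ν x) (t : Pt d) : excess μ ν t ≤ μ t := by
  rw [excess_eq]
  linarith [common_nonneg hμ0 hν0 t]

lemma projRestExcess_le (hμ0 : ∀ x, 0 ≤ μ x) (hν0 : ∀ x, 0 ≤ ν x) (i : Fin (n + 1))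
    (y : Conf n d) : projRestExcess μ ν γ i y ≤ projRestMass μ ν γ i y := by
  refine lintegral_mono fun t => ?_
  rw [← mul_assoc]
  refine (mul_le_mul_left ?_ _).trans (one_mul _).le
  calc _ ≤ ENNReal.ofReal (μ t) * ENNReal.ofReal (μ t)⁻¹ := by
        gcongr
        exact excess_le hμ0 hν0 t
    _ ≤ 1 := by
      rw [mul_comm, ofReal_inv_mul_ofReal (hμ0 t)]
      split_ifs <;> simp

variable (h : BorelDensities μ ν) (hγm : Measurable γ)
include h hγm

lemma measurable_projRestMass (i : Fin (n + 1)) : Measurable (projRestMass μ ν γ i) :=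
  (measurable_projRest h hγm i).lintegral_prod_left'

variable (hγ0 : ∀ x, 0 ≤ γ x) (hγ : Integrable γ)
  (hmarg : ∀ i, oneMarginal γ i =ᵐ[volume] μ)
include hγ0 hγ hmarg

lemma lintegral_projRest (i : Fin (n + 1)) : ∫⁻ z, projRest μ ν γ i z = 1 := by
  rw [Measure.volume_eq_prod, lintegral_prod _ (measurable_projRest h hγm i).aemeasurable,
    lintegral_congr_ae (ae_lintegral_projRest h hγm hγ0 hγ hmarg i),
    ← ofReal_integral_eq_lintegral_ofReal h.density_left.integrable h.density_left.nonneg,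
    h.density_left.integral_eq_one, ENNReal.ofReal_one]

lemma lintegral_projRestMass (i : Fin (n + 1)) : ∫⁻ y, projRestMass μ ν γ i y = 1 := by
  rw [← lintegral_projRest h hγm hγ0 hγ hmarg i, Measure.volume_eq_prod,
    lintegral_prod_symm _ (measurable_projRest h hγm i).aemeasurable]
  rfl

lemma ae_projRest_lt_top (i : Fin (n + 1)) : ∀ᵐ z, projRest μ ν γ i z < ⊤ :=
  ae_lt_top (measurable_projRest h hγm i) (by simp [lintegral_projRest h hγm hγ0 hγ hmarg i])

lemma ae_projRestMass_lt_top (i : Fin (n + 1)) : ∀ᵐ y, projRestMass μ ν γ i y < ⊤ :=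
  ae_lt_top (measurable_projRestMass h hγm i)
    (by simp [lintegral_projRestMass h hγm hγ0 hγ hmarg i])

/-- For fixed `t`, strong positivity is an inequality in the other coordinates, linear in `γ`.
Integrating it against the nonnegative weighted plan preserves it and turns the complementary
marginal into `projRestMass`. -/
lemma ae_mul_projRestMass_le {β : ℝ} (hβ : 0 < β) (i : Fin (n + 1))
    (hpos : ∀ᵐ x, β * oneMarginal γ i (x i) * restMarginal γ i (i.removeNth x) ≤ γ x) :
    ∀ᵐ z : Pt d × Conf n d, ENNReal.ofReal β * ENNReal.ofReal (μ z.1) * projRestMass μ ν γ i z.2 ≤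
      projRest μ ν γ i z := by
  have hγi : Measurable fun z : Pt d × Conf n d => ENNReal.ofReal (γ (i.insertNth z.1 z.2)) :=
    (hγm.comp (measurable_insertNth i)).ennreal_ofReal
  have h1 : ∀ᵐ z : Pt d × Conf n d, ENNReal.ofReal β * ENNReal.ofReal (μ z.1) *
      ∫⁻ t, ENNReal.ofReal (γ (i.insertNth t z.2)) ≤ ENNReal.ofReal (γ (i.insertNth z.1 z.2)) := by
    filter_upwards [(measurePreserving_insertNth i).quasiMeasurePreserving.ae hpos,
      Measure.quasiMeasurePreserving_fst.ae (hmarg i),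
      Measure.quasiMeasurePreserving_snd.ae (ae_lintegral_insertNth_rest hγ0 hγ i)]
      with z z1 z2 z3
    simp only [Fin.insertNth_apply_same, Fin.removeNth_insertNth] at z1
    rw [z2] at z1
    rw [z3, ← ENNReal.ofReal_mul hβ.le,
      ← ENNReal.ofReal_mul (mul_nonneg hβ.le (h.nonneg_left _))]
    exact ENNReal.ofReal_le_ofReal z1
  have hms : MeasurableSet {z : Pt d × Conf n d | ENNReal.ofReal β * ENNReal.ofReal (μ z.1) *
      projRestMass μ ν γ i z.2 ≤ projRest μ ν γ i z} :=
    measurableSet_le ((((h.meas_left.comp measurable_fst).ennreal_ofReal).const_mul _).mul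
      ((measurable_projRestMass h hγm i).comp measurable_snd)) (measurable_projRest h hγm i)
  refine (Measure.ae_prod_iff_ae_ae hms).2 ?_
  filter_upwards [Measure.ae_ae_of_ae_prod h1] with t ht
  filter_upwards [ae_ae_planPi h.meas_left h.meas_right h.nonneg_left h.nonneg_right
    h.density_left.integrable h.density_right.integrable h.integral_eq ht] with y hy
  have hfin := isFiniteMeasure_planPi h.density_left.integrable h.density_right.integrable y
  have e : projRestMass μ ν γ i y =
      ∫⁻ y', weight μ y' * (∫⁻ t, ENNReal.ofReal (γ (i.insertNth t y'))) ∂(planPi μ ν y) := by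
    unfold projRestMass projRest
    dsimp only
    rw [lintegral_lintegral_swap]
    · refine lintegral_congr fun y' => ?_
      exact lintegral_const_mul _ (hγi.comp measurable_prodMk_right)
    · exact (((measurable_weight h.meas_left).comp measurable_snd).mul hγi).aemeasurable
  rw [e, ← lintegral_const_mul' _ _ (ENNReal.mul_ne_top ENNReal.ofReal_ne_top
    ENNReal.ofReal_ne_top), projRest]
  refine lintegral_mono_ae ?_
  filter_upwards [hy] with y' hy'
  rw [mul_left_comm]
  gcongr

/-- Integrate the preceding lower bound against `f_A / μ` and use `∫ f_A = ∫ f_B`. -/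
lemma ae_mul_projRestMass_le_projRestExcess {β : ℝ} (hβ : 0 < β) (i : Fin (n + 1))
    (hpos : ∀ᵐ x, β * oneMarginal γ i (x i) * restMarginal γ i (i.removeNth x) ≤ γ x) :
    ∀ᵐ y, ENNReal.ofReal (∫ t, excess ν μ t) * (ENNReal.ofReal β * projRestMass μ ν γ i y) ≤
      projRestExcess μ ν γ i y := by
  have h1 := ae_mul_projRestMass_le h hγm hγ0 hγ hmarg hβ i hpos
  have h2 := Measure.ae_ae_of_ae_prod (Measure.measurePreserving_swap.quasiMeasurePreserving.ae h1)
  filter_upwards [h2] with y hy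
  rw [integral_excess_comm h.density_right.integrable h.density_left.integrable h.integral_eq.symm,
    ← lintegral_excess h.density_left.integrable h.density_right.integrable,
    ← lintegral_mul_const _ (measurable_excess h.meas_left h.meas_right).ennreal_ofReal]
  refine lintegral_mono_ae ?_
  filter_upwards [hy] with t ht
  simp only [Prod.swap_prod_mk] at ht
  by_cases h0 : μ t = 0
  · have : excess μ ν t ≤ 0 := (excess_le h.nonneg_left h.nonneg_right t).trans h0.le
    simp [ENNReal.ofReal_eq_zero.2 this]
  · refine mul_le_mul_right ?_ _
    calc ENNReal.ofReal β * projRestMass μ ν γ i y = ENNReal.ofReal (μ t)⁻¹ *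
          (ENNReal.ofReal β * ENNReal.ofReal (μ t) * projRestMass μ ν γ i y) := by
          have e := ofReal_inv_mul_ofReal (h.nonneg_left t)
          rw [if_neg h0] at e
          calc _ = 1 * (ENNReal.ofReal β * projRestMass μ ν γ i y) := (one_mul _).symm
            _ = _ := by rw [← e]; ring
      _ ≤ _ := mul_le_mul_right ht _

-- The Hellinger contraction on slices makes the regularity of `√μ` a consequence of that of `√γ`.
omit h hγ hmarg in
lemma lintegral_sqrt_marginal_sub_le (hμ0 : ∀ x, 0 ≤ μ x) (i : Fin (n + 1))
    (hmargE : ∀ᵐ t, ∫⁻ y, ENNReal.ofReal (γ (i.insertNth t y)) = ENNReal.ofReal (μ t))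
    (w : Pt d) :
    ∫⁻ t, ENNReal.ofReal ((√(μ (t + w)) - √(μ t)) ^ 2) ≤
      ∫⁻ z : Pt d × Conf n d, ENNReal.ofReal
        ((√(γ (i.insertNth (z.1 + w) z.2)) - √(γ (i.insertNth z.1 z.2))) ^ 2) := by
  have hγt : ∀ t, Measurable fun y => γ (i.insertNth t y) := fun t =>
    hγm.comp ((measurable_insertNth i).comp measurable_prodMk_left)
  have hm : Measurable fun z : Pt d × Conf n d => ENNReal.ofReal
      ((√(γ (i.insertNth (z.1 + w) z.2)) - √(γ (i.insertNth z.1 z.2))) ^ 2) := by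
    have m1 := hγm.comp (measurable_insertNth i)
    have m2 := m1.comp ((measurable_fst.add_const w).prodMk
      (measurable_snd (α := Pt d) (β := Conf n d)))
    exact ((m2.sqrt.sub m1.sqrt).pow_const 2).ennreal_ofReal
  rw [Measure.volume_eq_prod, lintegral_prod _ hm.aemeasurable]
  refine lintegral_mono_ae ?_
  filter_upwards [hmargE, (measurePreserving_add_right volume w).quasiMeasurePreserving.ae hmargE]
    with t h1 h2
  have := ofReal_sqrt_lintegral_sub_sq_le volume (hγt (t + w)).aemeasurable (hγt t).aemeasurable
    (fun y => hγ0 _) (fun y => hγ0 _) (by simp [h2]) (by simp [h1])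
  rwa [h1, h2, ENNReal.toReal_ofReal (hμ0 _), ENNReal.toReal_ofReal (hμ0 _)] at this

/-- The weight does not involve `t`, so it factors out of both roots. The Hellinger contraction
applies under the plan for each `y`, and integrating over `y` removes plan and weight. -/
lemma lintegral_sqrt_projRest_sub_le (i : Fin (n + 1)) (w : Pt d) :
    ∫⁻ z : Pt d × Conf n d, ENNReal.ofReal ((√(projRest μ ν γ i (z.1 + w, z.2)).toReal -
      √(projRest μ ν γ i z).toReal) ^ 2) ≤
      ∫⁻ z : Pt d × Conf n d, ENNReal.ofReal
        ((√(γ (i.insertNth (z.1 + w) z.2)) - √(γ (i.insertNth z.1 z.2))) ^ 2) := by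
  have hγt : ∀ t, Measurable fun y => γ (i.insertNth t y) := fun t =>
    hγm.comp ((measurable_insertNth i).comp measurable_prodMk_left)
  have hm : Measurable fun z : Pt d × Conf n d => ENNReal.ofReal
      ((√(γ (i.insertNth (z.1 + w) z.2)) - √(γ (i.insertNth z.1 z.2))) ^ 2) := by
    have m1 := hγm.comp (measurable_insertNth i)
    have m2 := m1.comp ((measurable_fst.add_const w).prodMk
      (measurable_snd (α := Pt d) (β := Conf n d)))
    exact ((m2.sqrt.sub m1.sqrt).pow_const 2).ennreal_ofReal
  have hw0 : ∀ y : Conf n d, 0 ≤ ∏ j, (μ (y j))⁻¹ := fun y =>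
    Finset.prod_nonneg fun j _ => inv_nonneg.2 (h.nonneg_left _)
  have hwm : Measurable fun y : Conf n d => ∏ j, (μ (y j))⁻¹ :=
    Finset.measurable_fun_prod _ fun j _ => (h.meas_left.comp (measurable_pi_apply j)).inv
  have htr : MeasurePreserving (Prod.map (fun t : Pt d => t + w) (id : Conf n d → Conf n d)) :=
    (measurePreserving_add_right volume w).prod (MeasurePreserving.id volume)
  have hfin := ae_projRest_lt_top h hγm hγ0 hγ hmarg i
  have hpt : ∀ᵐ z : Pt d × Conf n d, ENNReal.ofReal ((√(projRest μ ν γ i (z.1 + w, z.2)).toReal -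
      √(projRest μ ν γ i z).toReal) ^ 2) ≤ ∫⁻ y', weight μ y' * ENNReal.ofReal
        ((√(γ (i.insertNth (z.1 + w) y')) - √(γ (i.insertNth z.1 y'))) ^ 2)
        ∂(planPi μ ν z.2) := by
    filter_upwards [hfin, htr.quasiMeasurePreserving.ae hfin] with z z1 z2
    have e : ∀ t, projRest μ ν γ i (t, z.2) = ∫⁻ y', ENNReal.ofReal
        ((∏ j, (μ (y' j))⁻¹) * γ (i.insertNth t y')) ∂(planPi μ ν z.2) := by
      intro t
      simp_rw [ENNReal.ofReal_mul (hw0 _)]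
      rfl
    have z2' : projRest μ ν γ i (z.1 + w, z.2) < ⊤ := z2
    have z1' : projRest μ ν γ i (z.1, z.2) < ⊤ := z1
    change ENNReal.ofReal ((√(projRest μ ν γ i (z.1 + w, z.2)).toReal -
      √(projRest μ ν γ i (z.1, z.2)).toReal) ^ 2) ≤ _
    rw [e] at z1' z2'
    rw [e, e]
    refine (ofReal_sqrt_lintegral_sub_sq_le _ (hwm.mul (hγt _)).aemeasurable
      (hwm.mul (hγt _)).aemeasurable (fun y => mul_nonneg (hw0 y) (hγ0 _))
      (fun y => mul_nonneg (hw0 y) (hγ0 _)) z2'.ne z1'.ne).trans (le_of_eq ?_)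
    refine lintegral_congr fun y' => ?_
    simp only [Pi.mul_apply]
    rw [weight, ← ENNReal.ofReal_mul (hw0 y'), Real.sqrt_mul (hw0 y'), Real.sqrt_mul (hw0 y'),
      ← mul_sub, mul_pow, Real.sq_sqrt (hw0 y')]
  refine (lintegral_mono_ae hpt).trans ?_
  rw [Measure.volume_eq_prod]
  refine (lintegral_prod_le _).trans ?_
  rw [lintegral_prod _ hm.aemeasurable]
  refine lintegral_mono fun t => ?_
  exact lintegral_lintegral_planPi_le h.meas_left h.meas_right h.nonneg_left h.nonneg_right
    h.density_left.integrable h.density_right.integrable h.integral_eq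
    (hm.comp measurable_prodMk_left)

/-- The Dirac part evaluates `G` at `t` itself; the product part separates `t` from `y`, so that
moving `t` changes only `f_B`. -/
lemma ae_proj_insertNth_eq (i : Fin (n + 1)) : ∀ᵐ z : Pt d × Conf n d,
    proj μ ν γ (i.insertNth z.1 z.2) =
      common μ ν z.1 * (μ z.1)⁻¹ * (projRest μ ν γ i z).toReal +
        excess ν μ z.1 * ((∫ t, excess ν μ t)⁻¹ * (projRestExcess μ ν γ i z.2).toReal) := by
  filter_upwards [ae_projRest_lt_top h hγm hγ0 hγ hmarg i,
    Measure.quasiMeasurePreserving_snd.ae (ae_projRestMass_lt_top h hγm hγ0 hγ hmarg i)]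
    with z z1 z2
  have z3 := (projRestExcess_le h.nonneg_left h.nonneg_right i z.2).trans_lt z2
  rw [proj_eq_toReal hγm hγ0 h.meas_left h.nonneg_left, projE_insertNth_eq h hγm]
  change (_ + _ * projRestExcess μ ν γ i z.2).toReal = _
  change (ENNReal.ofReal _ * (_ * projRest μ ν γ i z) + _).toReal = _
  rw [ENNReal.toReal_add (by finiteness) (by finiteness)]
  simp only [ENNReal.toReal_mul]
  rw [ENNReal.toReal_ofReal (common_nonneg h.nonneg_left h.nonneg_right _),
    ENNReal.toReal_ofReal (inv_nonneg.2 (h.nonneg_left _)),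
    ENNReal.toReal_ofReal (div_nonneg (excess_nonneg _ _ _) (integral_excess_nonneg _ _))]
  ring

/-- Split `ν = f + f_B`: each part of the projected plan dominates `β R` times its own share. -/
lemma ae_mul_le_proj {β : ℝ} (hβ : 0 < β) (i : Fin (n + 1))
    (hpos : ∀ᵐ x, β * oneMarginal γ i (x i) * restMarginal γ i (i.removeNth x) ≤ γ x) :
    ∀ᵐ z : Pt d × Conf n d, β * ν z.1 * (projRestMass μ ν γ i z.2).toReal ≤
      common μ ν z.1 * (μ z.1)⁻¹ * (projRest μ ν γ i z).toReal +
        excess ν μ z.1 * ((∫ t, excess ν μ t)⁻¹ * (projRestExcess μ ν γ i z.2).toReal) := by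
  -- When `∫ f_B = 0` its inverse is read as `0` and the second term gives no lower bound; none is
  -- needed, since `f_B` then vanishes almost everywhere.
  have hex : ∀ᵐ t, (∫ t, excess ν μ t) = 0 → excess ν μ t = 0 := by
    by_cases h0 : (∫ t, excess ν μ t) = 0
    · filter_upwards [ae_excess_eq_zero h.density_right.integrable h.density_left.integrable h0]
        with t ht _ using ht
    · exact Filter.Eventually.of_forall fun t ht => absurd ht h0
  filter_upwards [ae_projRest_lt_top h hγm hγ0 hγ hmarg i,
    Measure.quasiMeasurePreserving_snd.ae (ae_projRestMass_lt_top h hγm hγ0 hγ hmarg i),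
    ae_mul_projRestMass_le h hγm hγ0 hγ hmarg hβ i hpos,
    Measure.quasiMeasurePreserving_snd.ae
      (ae_mul_projRestMass_le_projRestExcess h hγm hγ0 hγ hmarg hβ i hpos),
    Measure.quasiMeasurePreserving_fst.ae hex] with z z1 z2 z4 z5 z6
  have z3 := (projRestExcess_le h.nonneg_left h.nonneg_right i z.2).trans_lt z2
  have r4 := ENNReal.toReal_mono z1.ne z4
  have r5 := ENNReal.toReal_mono z3.ne z5
  have c0 := integral_excess_nonneg ν μ
  simp only [ENNReal.toReal_mul] at r4 r5
  rw [ENNReal.toReal_ofReal hβ.le, ENNReal.toReal_ofReal (h.nonneg_left _)] at r4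
  rw [ENNReal.toReal_ofReal hβ.le, ENNReal.toReal_ofReal c0] at r5
  have hR : 0 ≤ (projRestMass μ ν γ i z.2).toReal := ENNReal.toReal_nonneg
  have hcn := common_nonneg h.nonneg_left h.nonneg_right z.1
  have hen := excess_nonneg ν μ z.1
  have hsum : ν z.1 = common μ ν z.1 + excess ν μ z.1 := by
    rw [excess_eq, common_comm ν μ]
    ring
  generalize (projRestMass μ ν γ i z.2).toReal = R at *
  generalize (projRest μ ν γ i z).toReal = G at *
  generalize (projRestExcess μ ν γ i z.2).toReal = H at *
  have p1 : common μ ν z.1 * (β * R) ≤ common μ ν z.1 * (μ z.1)⁻¹ * G := by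
    by_cases h0 : μ z.1 = 0
    · have : common μ ν z.1 = 0 := le_antisymm ((min_le_left _ _).trans h0.le) hcn
      simp [this]
    · rw [mul_assoc]
      refine mul_le_mul_of_nonneg_left ?_ hcn
      rw [← div_eq_inv_mul, le_div_iff₀ ((h.nonneg_left _).lt_of_ne' h0)]
      linarith
  have p2 : excess ν μ z.1 * (β * R) ≤ excess ν μ z.1 * ((∫ t, excess ν μ t)⁻¹ * H) := by
    rcases c0.eq_or_lt with h0 | h0
    · simp [z6 h0.symm]
    · refine mul_le_mul_of_nonneg_left ?_ hen
      rw [← div_eq_inv_mul, le_div_iff₀ h0]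
      linarith
  rw [hsum]
  linarith

/-- The core estimate is used with `K = (∫ f_B)⁻¹`. The increment of `√γ` occurs twice: once
bounding that of `√G`, once that of `√μ`. -/
lemma lintegral_sqrt_proj_translate_le {β : ℝ} (hβ : 0 < β) (i : Fin (n + 1))
    (hpos : ∀ᵐ x, β * oneMarginal γ i (x i) * restMarginal γ i (i.removeNth x) ≤ γ x)
    (w : Pt d) :
    ∫⁻ x, ENNReal.ofReal ((√(proj μ ν γ (x + Pi.single i w)) - √(proj μ ν γ x)) ^ 2) ≤
      3 * ((∫⁻ x, ENNReal.ofReal ((√(γ (x + Pi.single i w)) - √(γ x)) ^ 2)) +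
        ((∫⁻ x, ENNReal.ofReal ((√(γ (x + Pi.single i w)) - √(γ x)) ^ 2)) +
          ∫⁻ t, ENNReal.ofReal ((√(ν (t + w)) - √(ν t)) ^ 2)) *
        ENNReal.ofReal (4 + 4 * (∫ t, excess ν μ t)⁻¹ ^ 2 / β)) := by
  have htr : MeasurePreserving (Prod.map (fun t : Pt d => t + w) (id : Conf n d → Conf n d)) :=
    (measurePreserving_add_right volume w).prod (MeasurePreserving.id volume)
  have heq := ae_proj_insertNth_eq h hγm hγ0 hγ hmarg i
  have hc0 := integral_excess_nonneg ν μ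
  rw [lintegral_sub_single (fun x => √(proj μ ν γ x)), lintegral_sub_single (fun x => √(γ x))]
  have e : ∫⁻ z : Pt d × Conf n d, ENNReal.ofReal ((√(proj μ ν γ (i.insertNth (z.1 + w) z.2)) -
      √(proj μ ν γ (i.insertNth z.1 z.2))) ^ 2) = _ := lintegral_congr_ae (by
    filter_upwards [heq, htr.quasiMeasurePreserving.ae heq] with z z1 z2
    simp only [Prod.map_fst, Prod.map_snd, id] at z2
    rw [z1, z2])
  rw [e]
  have hG : ∀ᵐ t, ∫⁻ y, ENNReal.ofReal (projRest μ ν γ i (t, y)).toReal ≤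
      ENNReal.ofReal (μ t) := by
    filter_upwards [ae_lintegral_projRest h hγm hγ0 hγ hmarg i] with t ht
    rw [← ht]
    exact lintegral_mono fun y => ENNReal.ofReal_toReal_le
  have hR : ∫⁻ y, ENNReal.ofReal (projRestMass μ ν γ i y).toReal ≤ 1 := by
    rw [← lintegral_projRestMass h hγm hγ0 hγ hmarg i]
    exact lintegral_mono fun y => ENNReal.ofReal_toReal_le
  have hhR : ∀ᵐ y, (∫ t, excess ν μ t)⁻¹ * (projRestExcess μ ν γ i y).toReal ≤
      (∫ t, excess ν μ t)⁻¹ * (projRestMass μ ν γ i y).toReal := by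
    filter_upwards [ae_projRestMass_lt_top h hγm hγ0 hγ hmarg i] with y hy
    exact mul_le_mul_of_nonneg_left (ENNReal.toReal_mono hy.ne
      (projRestExcess_le h.nonneg_left h.nonneg_right i y)) (inv_nonneg.2 hc0)
  refine (lintegral_sqrt_proj_sub_le (volume : Measure (Conf n d)) h.meas_left h.meas_right
    h.nonneg_left h.nonneg_right (measurable_projRest h hγm i).ennreal_toReal
    (fun z => ENNReal.toReal_nonneg) (measurable_projRestMass h hγm i).ennreal_toReal
    (fun y => ENNReal.toReal_nonneg)
    (fun y => mul_nonneg (inv_nonneg.2 hc0) ENNReal.toReal_nonneg) hβ (inv_nonneg.2 hc0) hG hhR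
    (ae_mul_le_proj h hγm hγ0 hγ hmarg hβ i hpos) hR w).trans ?_
  refine mul_le_mul_right (add_le_add ?_ (mul_le_mul_left ?_ _)) _
  · exact lintegral_sqrt_projRest_sub_le h hγm hγ0 hγ hmarg i w
  · have hm : Measurable fun t => ENNReal.ofReal ((√(μ (t + w)) - √(μ t)) ^ 2) := by
      have := h.meas_left
      fun_prop
    simp_rw [ENNReal.ofReal_add (sq_nonneg _) (sq_nonneg _)]
    rw [lintegral_add_left hm]
    gcongr
    exact lintegral_sqrt_marginal_sub_le hγm hγ0 h.nonneg_left i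
      (ae_lintegral_insertNth hγ0 hγ hmarg i) w

lemma translationLipschitz_sqrt_proj {β : ℝ} (hβ : 0 < β) (i : Fin (n + 1))
    (hpos : ∀ᵐ x, β * oneMarginal γ i (x i) * restMarginal γ i (i.removeNth x) ≤ γ x)
    (w : Pt d) (hγ' : TranslationLipschitz (fun x => √(γ x)) (Pi.single i w))
    (hν' : TranslationLipschitz (fun t => √(ν t)) w) :
    TranslationLipschitz (fun x => √(proj μ ν γ x)) (Pi.single i w) := by
  obtain ⟨C, hC, hCs⟩ := translationLipschitz_iff.1 hγ'
  obtain ⟨D, hD, hDs⟩ := translationLipschitz_iff.1 hν'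
  have hM : 0 ≤ 4 + 4 * (∫ t, excess ν μ t)⁻¹ ^ 2 / β := by positivity
  refine translationLipschitz_iff.2
    ⟨3 * (C + (C + D) * (4 + 4 * (∫ t, excess ν μ t)⁻¹ ^ 2 / β)), by positivity, fun s => ?_⟩
  have h1 := hCs s
  have h2 := hDs s
  have h3 := lintegral_sqrt_proj_translate_le h hγm hγ0 hγ hmarg hβ i hpos (s • w)
  rw [Pi.single_smul] at h3
  refine h3.trans ?_
  generalize 4 + 4 * (∫ t, excess ν μ t)⁻¹ ^ 2 / β = M at *
  calc _ ≤ 3 * (ENNReal.ofReal (C * s ^ 2) + (ENNReal.ofReal (C * s ^ 2) +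
        ENNReal.ofReal (D * s ^ 2)) * ENNReal.ofReal M) := by gcongr
    _ = _ := by
      rw [← ENNReal.ofReal_add (by positivity) (by positivity),
        ← ENNReal.ofReal_mul (by positivity), ← ENNReal.ofReal_add (by positivity) (by positivity),
        ← ENNReal.ofReal_ofNat 3, ← ENNReal.ofReal_mul (by norm_num)]
      congr 1
      ring

lemma memH1_sqrt_proj (hpos : StronglyPositive γ) (hγ' : MemH1 fun x => √(γ x))
    (hν' : MemH1 fun t => √(ν t)) : MemH1 fun x => √(proj μ ν γ x) := by
  obtain ⟨β, hβ, hpos⟩ := hpos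
  have hP := isProbDensity_proj h hγm hγ0 hγ hmarg
  have hP0 : ∀ x, 0 ≤ proj μ ν γ x := fun x => by
    rw [proj_eq_toReal hγm hγ0 h.meas_left h.nonneg_left]
    exact ENNReal.toReal_nonneg
  refine memH1_of_translationLipschitz_single ?_ fun i w => ?_
  · refine (memLp_two_iff_integrable_sq
      hP.integrable.aestronglyMeasurable.aemeasurable.sqrt.aestronglyMeasurable).2 ?_
    simp_rw [Real.sq_sqrt (hP0 _)]
    exact hP.integrable
  · exact translationLipschitz_sqrt_proj h hγm hγ0 hγ hmarg hβ i (hpos i) w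
      (hγ'.translationLipschitz _) (hν'.translationLipschitz _)

end Regularity

end SobPres

namespace SobPres

/-! ### Independence of the choice of representatives -/

section Congr

lemma IsProbDensity.congr {X : Type*} [MeasureSpace X] {ρ ρ' : X → ℝ} (h : IsProbDensity ρ)
    (e : ρ =ᵐ[volume] ρ') : IsProbDensity ρ' := by
  refine ⟨h.integrable.congr e, ?_, (integral_congr_ae e).symm.trans h.integral_eq_one⟩
  filter_upwards [e, h.nonneg] with x h1 h2
  rwa [← h1]

lemma MemH1.congr {X : Type*} [NormedAddCommGroup X] [NormedSpace ℝ X] [MeasureSpace X]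
    {u u' : X → ℝ} (h : MemH1 u) (e : u =ᵐ[volume] u') : MemH1 u' := by
  refine ⟨(memLp_congr_ae e).1 h.1, fun v => ?_⟩
  obtain ⟨g, hg, hw⟩ := h.2 v
  refine ⟨g, hg, fun φ hφ hc => ?_⟩
  rw [← hw φ hφ hc]
  refine integral_congr_ae ?_
  filter_upwards [e] with x hx
  rw [hx]

lemma IsProbDensity.exists_measurable_nonneg {X : Type*} [MeasureSpace X] {ρ : X → ℝ}
    (h : IsProbDensity ρ) :
    ∃ ρ' : X → ℝ, Measurable ρ' ∧ (∀ x, 0 ≤ ρ' x) ∧ ρ =ᵐ[volume] ρ' := by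
  have hm := h.integrable.aestronglyMeasurable.aemeasurable
  refine ⟨fun x => max (hm.mk ρ x) 0, hm.measurable_mk.max measurable_const,
    fun x => le_max_right _ _, ?_⟩
  filter_upwards [hm.ae_eq_mk, h.nonneg] with x h1 h2
  rw [← h1, max_eq_left h2]

variable {n d : ℕ} {γ γ' : Conf (n + 1) d → ℝ} {μ μ' ν ν' : Pt d → ℝ}

lemma oneMarginal_congr (e : γ =ᵐ[volume] γ') (i : Fin (n + 1)) :
    oneMarginal γ i =ᵐ[volume] oneMarginal γ' i := by
  filter_upwards [Measure.ae_ae_of_ae_prod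
    ((measurePreserving_insertNth i).quasiMeasurePreserving.ae e)] with t ht
  exact integral_congr_ae ht

lemma restMarginal_congr (e : γ =ᵐ[volume] γ') (i : Fin (n + 1)) :
    restMarginal γ i =ᵐ[volume] restMarginal γ' i := by
  filter_upwards [Measure.ae_ae_of_ae_prod (Measure.measurePreserving_swap.quasiMeasurePreserving.ae
    ((measurePreserving_insertNth i).quasiMeasurePreserving.ae e))] with y hy
  exact integral_congr_ae hy

lemma StronglyPositive.congr (h : StronglyPositive γ) (e : γ =ᵐ[volume] γ') :
    StronglyPositive γ' := by
  obtain ⟨β, hβ, h⟩ := h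
  refine ⟨β, hβ, fun i => ?_⟩
  have hq := (volume_preserving_piFinSuccAbove (fun _ : Fin (n + 1) => Pt d) i)
    |>.quasiMeasurePreserving
  filter_upwards [h i, e,
    hq.ae (Measure.quasiMeasurePreserving_fst.ae (oneMarginal_congr e i)),
    hq.ae (Measure.quasiMeasurePreserving_snd.ae (restMarginal_congr e i))] with x h1 h2 h3 h4
  change oneMarginal γ i (x i) = _ at h3
  change restMarginal γ i (i.removeNth x) = _ at h4
  rw [h2, h3, h4] at h1
  exact h1

lemma common_congr (eμ : μ =ᵐ[volume] μ') (eν : ν =ᵐ[volume] ν') :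
    common μ ν =ᵐ[volume] common μ' ν' := by
  filter_upwards [eμ, eν] with x h1 h2
  simp [common, h1, h2]

lemma excess_congr (eμ : μ =ᵐ[volume] μ') (eν : ν =ᵐ[volume] ν') :
    excess μ ν =ᵐ[volume] excess μ' ν' := by
  filter_upwards [eμ, eν] with x h1 h2
  simp [excess, common, h1, h2]

lemma planBA_congr (eμ : μ =ᵐ[volume] μ') (eν : ν =ᵐ[volume] ν') :
    ∀ᵐ x, planBA μ ν x = planBA μ' ν' x := by
  have h1 : volume.withDensity (fun x' => ENNReal.ofReal (excess μ ν x')) =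
      volume.withDensity fun x' => ENNReal.ofReal (excess μ' ν' x') := by
    refine withDensity_congr_ae ?_
    filter_upwards [excess_congr eμ eν] with x hx
    rw [hx]
  filter_upwards [common_congr eμ eν, excess_congr eν eμ] with x h2 h3
  rw [planBA, planBA, h1, h2, h3, integral_congr_ae (excess_congr eν eμ)]

/-- Changing `μ` or `γ` on a null set alters the integrand on a null set of `x'`, which the product
plan ignores for almost every `x` despite its atoms. -/
lemma proj_congr (h : BorelDensities μ' ν') (eμ : μ =ᵐ[volume] μ') (eν : ν =ᵐ[volume] ν')
    (e : γ =ᵐ[volume] γ') : proj μ ν γ =ᵐ[volume] proj μ' ν' γ' := by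
  have hev : ∀ {p : Pt d → Prop}, (∀ᵐ t, p t) → ∀ᵐ x : Conf (n + 1) d, ∀ i, p (x i) := fun hp =>
    ae_all_iff.2 fun i => (Measure.quasiMeasurePreserving_eval (fun _ => volume) i).ae hp
  have hint : ∀ᵐ x : Conf (n + 1) d,
      (∏ i, (μ (x i))⁻¹) * γ x = (∏ i, (μ' (x i))⁻¹) * γ' x := by
    filter_upwards [hev eμ, e] with x h1 h2
    simp_rw [h1, h2]
  filter_upwards [hev (planBA_congr eμ eν), ae_ae_planPi h.meas_left h.meas_right h.nonneg_left
    h.nonneg_right h.density_left.integrable h.density_right.integrable h.integral_eq hint]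
    with x h1 h2
  rw [proj, proj]
  simp_rw [h1]
  exact integral_congr_ae h2

lemma isProbDensity_of_oneMarginal (hγ : IsProbDensity γ) (i : Fin (n + 1))
    (hmarg : oneMarginal γ i =ᵐ[volume] μ) : IsProbDensity μ := by
  have h1 : Integrable fun z : Pt d × Conf n d => γ (i.insertNth z.1 z.2) :=
    (measurePreserving_insertNth i).integrable_comp_of_integrable hγ.integrable
  refine IsProbDensity.congr (ρ := oneMarginal γ i) ⟨h1.integral_prod_left, ?_, ?_⟩ hmarg
  · filter_upwards [Measure.ae_ae_of_ae_prod
      ((measurePreserving_insertNth i).quasiMeasurePreserving.ae hγ.nonneg)] with t ht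
    exact integral_nonneg_of_ae ht
  · rw [← hγ.integral_eq_one, ← (measurePreserving_insertNth i).integral_comp
      (MeasurableEquiv.piFinSuccAbove (fun _ => Pt d) i).symm.measurableEmbedding γ,
      Measure.volume_eq_prod, integral_prod _ h1]
    rfl

end Congr

end SobPres

theorem theorem2p3 (n d : ℕ)
    (γA : SobPres.Conf (n + 1) d → ℝ) (μA μB : SobPres.Pt d → ℝ)
    (hγA : SobPres.IsProbDensity γA)
    (hmarg : ∀ i : Fin (n + 1), SobPres.oneMarginal γA i =ᵐ[MeasureTheory.volume] μA)
    (hμB : SobPres.IsProbDensity μB)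
    (hγA_H1 : SobPres.MemH1 (fun x => √(γA x)))
    (hμB_H1 : SobPres.MemH1 (fun t => √(μB t)))
    (hpos : SobPres.StronglyPositive γA) :
    SobPres.IsProbDensity (SobPres.proj μA μB γA) ∧
      (∀ i : Fin (n + 1),
        SobPres.oneMarginal (SobPres.proj μA μB γA) i =ᵐ[MeasureTheory.volume] μB) ∧
      SobPres.MemH1 (fun x => √(SobPres.proj μA μB γA x)) := by
  have hμA := SobPres.isProbDensity_of_oneMarginal hγA 0 (hmarg 0)
  -- The three densities are replaced by Borel representatives that are nonnegative everywhere; the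
  -- results transfer back almost everywhere.
  obtain ⟨γ, hγm, hγ0, eγ⟩ := hγA.exists_measurable_nonneg
  obtain ⟨μ, hμm, hμ0, eμ⟩ := hμA.exists_measurable_nonneg
  obtain ⟨ν, hνm, hν0, eν⟩ := hμB.exists_measurable_nonneg
  have h : SobPres.BorelDensities μ ν := ⟨hμm, hνm, hμ0, hν0, hμA.congr eμ, hμB.congr eν⟩
  have hγ := (hγA.congr eγ).integrable
  have hmarg' : ∀ i, SobPres.oneMarginal γ i =ᵐ[MeasureTheory.volume] μ := fun i =>
    (SobPres.oneMarginal_congr eγ i).symm.trans ((hmarg i).trans eμ)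
  have e := (SobPres.proj_congr h eμ eν eγ).symm
  have hsqrt : ∀ {X : Type} [MeasureSpace X] {u v : X → ℝ}, u =ᵐ[volume] v →
      (fun x => √(u x)) =ᵐ[volume] fun x => √(v x) := fun huv => huv.fun_comp _
  refine ⟨(SobPres.isProbDensity_proj h hγm hγ0 hγ hmarg').congr e, fun i => ?_, ?_⟩
  · exact (SobPres.oneMarginal_congr e i).symm.trans
      ((SobPres.oneMarginal_proj h hγm hγ0 hγ hmarg' i).trans eν.symm)
  · exact (SobPres.memH1_sqrt_proj h hγm hγ0 hγ hmarg' (hpos.congr eγ)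
      (hγA_H1.congr (hsqrt eγ)) (hμB_H1.congr (hsqrt eν))).congr (hsqrt e)
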